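/- Let a stationary, axisymmetric, circular spacetime be given in Hartle–Thorne type coordinates $(t,r,\theta,\phi)$, $r>r_H$, by $$ds^2=-N^2dt^2+A^2dr^2+r^2B^2\left\{d\theta^2+\sin^2\theta\,(d\phi-\omega\,dt)^2\right\},$$ where $N,A,B>0$ and $\omega$ are functions of $(r,\theta)$, of class $C^2$ for $r>r_H$ (including on the symmetry axis). Assume: 1. *(Reflection symmetry)* $g_{\mu\nu}(r,\theta)=g_{\mu\nu}(r,\pi-\theta)$. 2. *(Asymptotically mass centred coordinates)* $N,A,B,\omega$ have smooth expansions in powers of $1/r$ near spatial infinity (as functions of $(1/r,\theta)$ they extend smoothly to $1/r=0$), and, uniformly in $\theta$, $B=1+O(r^{-2})$, $N=1-\frac Mr+O(r^{-2})$, $A=1+\frac Mr+O(r^{-2})$, $\omega=\frac{2J}{r^3}+O(r^{-4})$, where $M$ is the mass and $J$ the angular momentum. 3. *(BH or NS)* Either (black hole) $r_H>0$ and $r=r_H$ is a horizon with constant angular velocity $\Omega_H$: as $r\to r_H$, uniformly in $\theta$, $N\to0$, $\omega\to\Omega_H$, and $r^2B^2$ stays bounded; or (neutron star) $r_H=0$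 and $r=0$ is a regular centre: as $r\to0$, uniformly in $\theta$, $N$ has a positive limit, $A$ and $B$ have the same positive limit, and $\omega$ has a limit. Call a function $f(r,\theta)$ *regular* if it is $C^2$ for $r>r_H$ (including on the axis) and $f$ and $g^{\mu\nu}\partial_\mu f\,\partial_\nu f$ are bounded as $r\to r_H$. Let $\mathcal R_{GB}=R^2-4R_{\mu\nu}R^{\mu\nu}+R_{\alpha\beta\gamma\delta}R^{\alpha\beta\gamma\delta}$. Then: (i) $\mathcal R_{GB}(r,\theta)=\mathcal R_{GB}(r,\pi-\theta)$ for all $r>r_H$, $0<\theta<\pi$. (ii) Every regular solution $\phi_0(r,\theta)$ of $\Box\phi_0=0$ such that $\phi_0/r$ has a smooth expansion in powers of $1/r$ and $\phi_0=r\cos\theta\,\bigl[1+\frac{\phi_1(\theta)}{r}\bigr]+O(r^{-1})$ uniformly in $\theta$, for some function $\phi_1$, satisfies $\phi_0(r,\pi-\theta)=-\phi_0(r,\theta)$. (iii) Let $\epsilon\in\mathbb R$ and let $\Phi(r,\theta)$ be a regular solution of the shift-symmetric scalar Gauss–Bonnet scalar equation $\Box\Phi+\epsilon\,\mathcal R_{GB}=0$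 with a smooth expansion in powers of $1/r$, $\Phi=\frac{\mu_1(\theta)}{r}+\frac{\mu_2(\theta)}{r^2}+O(r^{-3})$ uniformly in $\theta$. Then the monopole hair $\mu_1(\theta)=\mu_1$ is constant, $\mu_2(\theta)=M\mu_1+\mu_{(2,1)}\cos\theta$, where $$\mu_{(2,1)}=\frac32\int_0^\pi\mu_2(\theta)\cos\theta\sin\theta\,d\theta$$ is the $\ell=1$ mode of the dipole hair, and $\mu_{(2,1)}=0$. Hence, uniformly in $\theta$, $$\Phi(r,\theta)=\frac{\mu_1}{r}+\frac{M\mu_1}{r^2}+O(r^{-3}).$$ The result is exact in $\epsilon$ (no perturbative expansion is made), and holds for both neutron-star and black-hole spacetimes. -/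

import Mathlib

open Filter Topology Set Asymptotics

noncomputable section

namespace SGB

/-! ### Lorentzian geometry in a coordinate chart of dimension four -/

/-- Partial derivative of `f` with respect to the coordinate `x^μ`. -/
def pd (μ : Fin 4) (f : (Fin 4 → ℝ) → ℝ) (x : Fin 4 → ℝ) : ℝ :=
  deriv (fun s => f (Function.update x μ s)) (x μ)

/-- A metric in a chart: its matrix of components `g_{μν}` at each coordinate point. -/
abbrev MetricField := (Fin 4 → ℝ) → Matrix (Fin 4) (Fin 4) ℝ

/-- Christoffel symbols of the Levi-Civita connection, `Γ^l_{mn}`. -/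
def christoffel (g : MetricField) (l m n : Fin 4) (x : Fin 4 → ℝ) : ℝ :=
  (1 / 2) * ∑ s, (g x)⁻¹ l s *
    (pd m (fun y => g y s n) x + pd n (fun y => g y s m) x - pd s (fun y => g y m n) x)

/-- Riemann tensor `R^a_{bmn}`. -/
def riemann (g : MetricField) (a b m n : Fin 4) (x : Fin 4 → ℝ) : ℝ :=
  pd m (christoffel g a n b) x - pd n (christoffel g a m b) x
    + ∑ l, (christoffel g a m l x * christoffel g l n b x
        - christoffel g a n l x * christoffel g l m b x)

/-- Ricci tensor `R_{bn} = R^a_{ban}`. -/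
def ricci (g : MetricField) (b n : Fin 4) (x : Fin 4 → ℝ) : ℝ :=
  ∑ a, riemann g a b a n x

/-- Ricci scalar `R = g^{bn} R_{bn}`. -/
def ricciScalar (g : MetricField) (x : Fin 4 → ℝ) : ℝ :=
  ∑ b, ∑ n, (g x)⁻¹ b n * ricci g b n x

/-- `R_{μν} R^{μν}`. -/
def ricciSq (g : MetricField) (x : Fin 4 → ℝ) : ℝ :=
  ∑ a, ∑ b, ∑ c, ∑ d, (g x)⁻¹ a c * (g x)⁻¹ b d * ricci g a b x * ricci g c d x

/-- `R_{αβγδ} R^{αβγδ} = g_{ae} g^{bf} g^{cp} g^{dq} R^a_{bcd} R^e_{fpq}`. -/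
def riemannSq (g : MetricField) (x : Fin 4 → ℝ) : ℝ :=
  ∑ a, ∑ b, ∑ c, ∑ d, ∑ e, ∑ f, ∑ p, ∑ q,
    g x a e * (g x)⁻¹ b f * (g x)⁻¹ c p * (g x)⁻¹ d q *
      riemann g a b c d x * riemann g e f p q x

/-- The Gauss–Bonnet invariant `R² - 4 R_{μν} R^{μν} + R_{αβγδ} R^{αβγδ}`. -/
def gaussBonnet (g : MetricField) (x : Fin 4 → ℝ) : ℝ :=
  ricciScalar g x ^ 2 - 4 * ricciSq g x + riemannSq g x

/-- The wave operator `□ f = |det g|^{-1/2} ∂_μ (|det g|^{1/2} g^{μν} ∂_ν f)`. -/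
def box (g : MetricField) (f : (Fin 4 → ℝ) → ℝ) (x : Fin 4 → ℝ) : ℝ :=
  (Real.sqrt |(g x).det|)⁻¹ *
    ∑ m, pd m (fun y => Real.sqrt |(g y).det| * ∑ n, (g y)⁻¹ m n * pd n f y) x

/-! ### Hartle–Thorne type coordinates `(t, r, θ, φ)` -/

/-- The metric functions of a stationary, axisymmetric and circular spacetime, as functions of
`(r, θ)`. -/
structure MetricFunctions where
  N : ℝ → ℝ → ℝ
  A : ℝ → ℝ → ℝ
  B : ℝ → ℝ → ℝ
  ω : ℝ → ℝ → ℝ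

/-- `ds² = -N² dt² + A² dr² + r² B² (dθ² + sin² θ (dφ - ω dt)²)`; the coordinates
`x 0, x 1, x 2, x 3` are `t, r, θ, φ`. -/
def MetricFunctions.metric (h : MetricFunctions) : MetricField := fun x =>
  let r := x 1
  let θ := x 2
  let P := r ^ 2 * h.B r θ ^ 2 * Real.sin θ ^ 2
  !![-h.N r θ ^ 2 + P * h.ω r θ ^ 2, 0, 0, -P * h.ω r θ;
     0, h.A r θ ^ 2, 0, 0;
     0, 0, r ^ 2 * h.B r θ ^ 2, 0;
     -P * h.ω r θ, 0, 0, P]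

/-- A stationary and axisymmetric scalar, seen as a function on the chart. -/
def onChart (f : ℝ → ℝ → ℝ) : (Fin 4 → ℝ) → ℝ := fun x => f (x 1) (x 2)

/-- The polar angle ranges over `[0, π]`; a function of `(r, θ)` is extended to all real `θ` as an
even `2π`-periodic function. It then defines a `C²` function of the point of three-space with polar
coordinates `(r, θ, φ)`, on the symmetry axis included, exactly when the extension is `C²`. -/
structure IsRegularOutside (rH : ℝ) (f : ℝ → ℝ → ℝ) : Prop where
  contDiffOn : ContDiffOn ℝ 2 (fun p : ℝ × ℝ => f p.1 p.2) (Ioi rH ×ˢ univ)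
  even : ∀ r > rH, ∀ θ, f r (-θ) = f r θ
  periodic : ∀ r > rH, ∀ θ, f r (θ + 2 * Real.pi) = f r θ

/-- `f` admits a smooth expansion in powers of `1/r` near spatial infinity: as a function of
`(1/r, θ)` it extends smoothly to `1/r = 0`. -/
def SmoothAtInfinity (f : ℝ → ℝ → ℝ) : Prop :=
  ∃ δ > 0, ∃ F : ℝ × ℝ → ℝ, ContDiffOn ℝ (⊤ : ℕ∞) F (Ioo (-δ) δ ×ˢ univ) ∧
    ∀ r > δ⁻¹, ∀ θ, f r θ = F (r⁻¹, θ)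

/-- `f(r, θ) = O(r^{-n})` as `r → ∞`, uniformly in `θ`. -/
def IsBigOInv (n : ℕ) (f : ℝ → ℝ → ℝ) : Prop :=
  (fun p : ℝ × ℝ => f p.1 p.2) =O[atTop ×ˢ (⊤ : Filter ℝ)] fun p => (p.1 ^ n)⁻¹

/-- The functions define a Lorentzian metric of class `C²` on the region `r > rH`. -/
structure MetricFunctions.IsSpacetime (h : MetricFunctions) (rH : ℝ) : Prop where
  regN : IsRegularOutside rH h.N
  regA : IsRegularOutside rH h.A
  regB : IsRegularOutside rH h.B
  regω : IsRegularOutside rH h.ω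
  posN : ∀ r > rH, ∀ θ, 0 < h.N r θ
  posA : ∀ r > rH, ∀ θ, 0 < h.A r θ
  posB : ∀ r > rH, ∀ θ, 0 < h.B r θ

/-- Reflection symmetry of the metric, `g_{μν}(r, θ) = g_{μν}(r, π - θ)`. -/
def MetricFunctions.IsReflectionSymmetric (h : MetricFunctions) (rH : ℝ) : Prop :=
  ∀ t φ : ℝ, ∀ r > rH, ∀ θ ∈ Ioo 0 Real.pi,
    h.metric ![t, r, θ, φ] = h.metric ![t, r, Real.pi - θ, φ]

/-- The coordinates are asymptotically mass centred, with mass `M` and angular momentum `J`. -/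
structure MetricFunctions.IsAMC (h : MetricFunctions) (M J : ℝ) : Prop where
  smoothN : SmoothAtInfinity h.N
  smoothA : SmoothAtInfinity h.A
  smoothB : SmoothAtInfinity h.B
  smoothω : SmoothAtInfinity h.ω
  expandB : IsBigOInv 2 fun r θ => h.B r θ - 1
  expandN : IsBigOInv 2 fun r θ => h.N r θ - (1 - M / r)
  expandA : IsBigOInv 2 fun r θ => h.A r θ - (1 + M / r)
  expandω : IsBigOInv 4 fun r θ => h.ω r θ - 2 * J / r ^ 3

/-- The approach to the inner end `r → rH` of the region, uniformly in `θ`. -/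
def innerEnd (rH : ℝ) : Filter (ℝ × ℝ) := 𝓝[>] rH ×ˢ (⊤ : Filter ℝ)

/-- Black hole: the region `r > rH` ends at an event horizon. There the generator
`X = ∂_t + ΩH ∂_φ` becomes null and orthogonal to the rotational Killing field, that is `N → 0` and
`ω → ΩH` for a constant `ΩH`, while the sections of constant `r` do not blow up. -/
structure MetricFunctions.IsBlackHole (h : MetricFunctions) (rH : ℝ) : Prop where
  pos : 0 < rH
  lapse : Tendsto (fun p : ℝ × ℝ => h.N p.1 p.2) (innerEnd rH) (𝓝 0)
  angular : ∃ ΩH : ℝ, Tendsto (fun p : ℝ × ℝ => h.ω p.1 p.2) (innerEnd rH) (𝓝 ΩH)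
  area : (fun p : ℝ × ℝ => p.1 ^ 2 * h.B p.1 p.2 ^ 2) =O[innerEnd rH] fun _ => (1 : ℝ)

/-- Neutron star: there is no horizon, and `r = 0` is a regular centre, at which the metric has a
continuous nondegenerate limit. -/
structure MetricFunctions.IsNeutronStar (h : MetricFunctions) (rH : ℝ) : Prop where
  zero : rH = 0
  lapse : ∃ c > 0, Tendsto (fun p : ℝ × ℝ => h.N p.1 p.2) (innerEnd rH) (𝓝 c)
  spatial : ∃ a > 0, Tendsto (fun p : ℝ × ℝ => h.A p.1 p.2) (innerEnd rH) (𝓝 a) ∧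
    Tendsto (fun p : ℝ × ℝ => h.B p.1 p.2) (innerEnd rH) (𝓝 a)
  angular : ∃ w : ℝ, Tendsto (fun p : ℝ × ℝ => h.ω p.1 p.2) (innerEnd rH) (𝓝 w)

/-- `f` is regular at the horizon (at the centre, for a star): `f` and the scalar
`g^{μν} ∂_μ f ∂_ν f = A⁻² (∂_r f)² + (r B)⁻² (∂_θ f)²` stay bounded. Every `f` with a `C¹` extension
through the horizon or the centre, in coordinates in which the metric is regular there, satisfies
this. -/
structure MetricFunctions.IsRegularInside (h : MetricFunctions) (rH : ℝ) (f : ℝ → ℝ → ℝ) :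
    Prop where
  bounded : (fun p : ℝ × ℝ => f p.1 p.2) =O[innerEnd rH] fun _ => (1 : ℝ)
  gradient : (fun p : ℝ × ℝ =>
      (deriv (fun s => f s p.2) p.1 / h.A p.1 p.2) ^ 2 +
        (deriv (fun s => f p.1 s) p.2 / (p.1 * h.B p.1 p.2)) ^ 2)
      =O[innerEnd rH] fun _ => (1 : ℝ)

/-- The scalar field of shift-symmetric scalar Gauss–Bonnet theory with coupling `ε`: a stationary
axisymmetric scalar, regular on the axis and at the horizon or centre, that solves
`□Φ + ε R_GB = 0` and has the expansion `μ₁(θ)/r + μ₂(θ)/r² + O(r^{-3})` near spatial infinity, with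
monopole hair `μ₁(θ)` and dipole hair `μ₂(θ)`. -/
structure MetricFunctions.IsSGBScalar (h : MetricFunctions) (rH ε : ℝ) (Φ : ℝ → ℝ → ℝ)
    (μ₁ μ₂ : ℝ → ℝ) : Prop where
  regular : IsRegularOutside rH Φ
  inside : h.IsRegularInside rH Φ
  equation : ∀ t φ : ℝ, ∀ r > rH, ∀ θ ∈ Ioo 0 Real.pi,
    box h.metric (onChart Φ) ![t, r, θ, φ] + ε * gaussBonnet h.metric ![t, r, θ, φ] = 0
  smooth : SmoothAtInfinity Φ
  expand : IsBigOInv 3 fun r θ => Φ r θ - (μ₁ θ / r + μ₂ θ / r ^ 2)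

/-- The homogeneous solution `φ₀`: a stationary axisymmetric solution of `□φ₀ = 0`, regular on the
axis and at the horizon or centre, with `φ₀ = r P₁(cos θ) (1 + φ₁(θ)/r) + O(r^{-1})` near spatial
infinity for some function `φ₁`; here `P₁(x) = x`. -/
structure MetricFunctions.IsHomogeneousSolution (h : MetricFunctions) (rH : ℝ)
    (φ₀ : ℝ → ℝ → ℝ) : Prop where
  regular : IsRegularOutside rH φ₀
  inside : h.IsRegularInside rH φ₀
  equation : ∀ t φ : ℝ, ∀ r > rH, ∀ θ ∈ Ioo 0 Real.pi,
    box h.metric (onChart φ₀) ![t, r, θ, φ] = 0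
  smooth : SmoothAtInfinity fun r θ => φ₀ r θ / r
  expand : ∃ φ₁ : ℝ → ℝ, IsBigOInv 1 fun r θ => φ₀ r θ - r * Real.cos θ * (1 + φ₁ θ / r)

/-- The `ℓ = 1` mode of a function on the sphere that depends on `θ` only: its coefficient along
`P₁(cos θ) = cos θ` in the expansion in Legendre polynomials of `cos θ`. -/
def modeOne (f : ℝ → ℝ) : ℝ :=
  (3 / 2) * ∫ θ in (0 : ℝ)..Real.pi, f θ * Real.cos θ * Real.sin θ

end SGB

end

/-!
The reflection `θ ↦ π - θ` is an isometry, and a scalar such as the Gauss–Bonnet invariant, being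
assembled from tensors with a definite parity in each index, is even under it.

A stationary axisymmetric solution `χ` of `□χ = 0` that is regular inside and tends to zero at
infinity vanishes: the energy integral `∫ √-g (∂χ)²` equals the flux `N r² B² A⁻¹ χ ∂_r χ` through
the spheres at the two ends. This flux vanishes at infinity by decay, at a horizon because `N → 0`,
and at a centre because `r² → 0`. If `χ` is merely bounded at infinity, its limit is harmonic on the
sphere, hence constant, and it suffices that this constant is zero. The even part
`φ₀ + φ₀ ∘ (θ ↦ π - θ)` of the homogeneous solution is such a `χ`: its growing part cancels and its
limit vanishes on the equator.

Near infinity `R_GB = o(r⁻⁴)`, so the source does not enter the two leading orders of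
`□Φ = -ε R_GB`. They say that `μ₁` is harmonic on the sphere, hence constant, and that `μ₂ - M μ₁`
is an eigenfunction with `ℓ = 1`, regular on the axis, hence a multiple of `cos θ`. Finally
`Φ - Φ ∘ (θ ↦ π - θ)` solves the homogeneous equation and decays, so `Φ` is even and the multiple
is zero.
-/

noncomputable section

namespace SGB

/-! ### The wave operator -/

theorem pd_congr {U : Set (Fin 4 → ℝ)} (hU : IsOpen U) {f g : (Fin 4 → ℝ) → ℝ} (hfg : EqOn f g U)
    (m : Fin 4) {x : Fin 4 → ℝ} (hx : x ∈ U) : pd m f x = pd m g x := by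
  have hline : ContinuousAt (fun s => Function.update x m s) (x m) :=
    (continuous_const.update m continuous_id).continuousAt
  have hmem : ∀ᶠ s in 𝓝 (x m), Function.update x m s ∈ U :=
    hline.preimage_mem_nhds (by simpa using hU.mem_nhds hx)
  exact EventuallyEq.deriv_eq (hmem.mono fun s hs => hfg hs)

theorem pd_one_onChart (f : ℝ → ℝ → ℝ) (x : Fin 4 → ℝ) :
    pd 1 (onChart f) x = deriv (fun s => f s (x 2)) (x 1) := by
  simp [pd, onChart]

theorem pd_two_onChart (f : ℝ → ℝ → ℝ) (x : Fin 4 → ℝ) :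
    pd 2 (onChart f) x = deriv (f (x 1)) (x 2) := by
  simp [pd, onChart]

/-- The vector density `|det g|^{1/2} g^{μν} ∂_ν f`, whose coordinate divergence is
`|det g|^{1/2} □f`. -/
def gradientDensity (g : MetricField) (f : (Fin 4 → ℝ) → ℝ) (m : Fin 4) (x : Fin 4 → ℝ) : ℝ :=
  Real.sqrt |(g x).det| * ∑ n, (g x)⁻¹ m n * pd n f x

theorem box_eq_divergence (g : MetricField) (f : (Fin 4 → ℝ) → ℝ) (x : Fin 4 → ℝ) :
    box g f x = (Real.sqrt |(g x).det|)⁻¹ * ∑ m, pd m (gradientDensity g f m) x := rfl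

/-- The part `r > rH`, `0 < θ < π` of the chart, where the coordinates are nondegenerate. -/
def chartDomain (rH : ℝ) : Set (Fin 4 → ℝ) := {x | rH < x 1 ∧ x 2 ∈ Ioo 0 Real.pi}

theorem isOpen_chartDomain (rH : ℝ) : IsOpen (chartDomain rH) :=
  (isOpen_lt continuous_const (continuous_apply 1)).inter
    (isOpen_Ioo.preimage (continuous_apply 2))

namespace MetricFunctions

/-- The components `g^{μν}` of the inverse metric. -/
def metricInv (h : MetricFunctions) : MetricField := fun x =>
  let r := x 1
  let θ := x 2
  let P := r ^ 2 * h.B r θ ^ 2 * Real.sin θ ^ 2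
  !![-(h.N r θ ^ 2)⁻¹, 0, 0, -(h.ω r θ * (h.N r θ ^ 2)⁻¹);
     0, (h.A r θ ^ 2)⁻¹, 0, 0;
     0, 0, (r ^ 2 * h.B r θ ^ 2)⁻¹, 0;
     -(h.ω r θ * (h.N r θ ^ 2)⁻¹), 0, 0, P⁻¹ - h.ω r θ ^ 2 * (h.N r θ ^ 2)⁻¹]

/-- The density `|det g|^{1/2}`. -/
def volumeDensity (h : MetricFunctions) (r θ : ℝ) : ℝ :=
  h.N r θ * h.A r θ * (r ^ 2 * h.B r θ ^ 2) * Real.sin θ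

/-- The coefficient of `sin θ ∂_r f` in the density `|det g|^{1/2} g^{rr} ∂_r f`. -/
def radialCoeff (h : MetricFunctions) (r θ : ℝ) : ℝ :=
  h.N r θ * (r ^ 2 * h.B r θ ^ 2) / h.A r θ

/-- The coefficient of `sin θ ∂_θ f` in the density `|det g|^{1/2} g^{θθ} ∂_θ f`. -/
def angularCoeff (h : MetricFunctions) (r θ : ℝ) : ℝ := h.N r θ * h.A r θ

/-- The radial component of the gradient density of `f`, with the factor `sin θ` left out. -/
def radialFlux (h : MetricFunctions) (f : ℝ → ℝ → ℝ) (r θ : ℝ) : ℝ :=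
  h.radialCoeff r θ * deriv (fun s => f s θ) r

/-- The polar component of the gradient density of `f`, including the factor `sin θ`, so that it
vanishes on the axis. -/
def angularFlux (h : MetricFunctions) (f : ℝ → ℝ → ℝ) (r θ : ℝ) : ℝ :=
  h.angularCoeff r θ * Real.sin θ * deriv (f r) θ

/-- The wave operator on functions of `(r, θ)`, multiplied by the density `|det g|^{1/2}`. -/
def waveOp (h : MetricFunctions) (f : ℝ → ℝ → ℝ) (r θ : ℝ) : ℝ :=
  deriv (fun s => h.radialFlux f s θ) r * Real.sin θ + deriv (h.angularFlux f r) θ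

theorem det_metric (h : MetricFunctions) (x : Fin 4 → ℝ) :
    (h.metric x).det = -(h.volumeDensity (x 1) (x 2)) ^ 2 := by
  simp [metric, volumeDensity, Matrix.det_succ_row_zero, Fin.sum_univ_succ, Fin.succAbove]
  ring

theorem inv_metric (h : MetricFunctions) (x : Fin 4 → ℝ) (hN : h.N (x 1) (x 2) ≠ 0)
    (hA : h.A (x 1) (x 2) ≠ 0) (hB : h.B (x 1) (x 2) ≠ 0) (hr : x 1 ≠ 0)
    (hsin : Real.sin (x 2) ≠ 0) : (h.metric x)⁻¹ = h.metricInv x := by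
  apply Matrix.inv_eq_right_inv
  ext i j
  fin_cases i <;> fin_cases j <;>
    simp [metric, metricInv, Matrix.mul_apply, Fin.sum_univ_succ] <;> field_simp <;> ring

section

variable {h : MetricFunctions} {rH : ℝ} (hs : h.IsSpacetime rH) (h0 : 0 ≤ rH)

include hs h0

theorem IsSpacetime.volumeDensity_pos {r θ : ℝ} (hr : rH < r) (hθ : θ ∈ Ioo 0 Real.pi) :
    0 < h.volumeDensity r θ := by
  have := hs.posN r hr θ
  have := hs.posA r hr θ
  have := hs.posB r hr θ
  have := h0.trans_lt hr
  have := Real.sin_pos_of_mem_Ioo hθ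
  unfold volumeDensity
  positivity

theorem IsSpacetime.sqrt_abs_det_metric {x : Fin 4 → ℝ} (hx : x ∈ chartDomain rH) :
    Real.sqrt |(h.metric x).det| = h.volumeDensity (x 1) (x 2) := by
  rw [h.det_metric, abs_neg, abs_of_nonneg (sq_nonneg _),
    Real.sqrt_sq (hs.volumeDensity_pos h0 hx.1 hx.2).le]

theorem IsSpacetime.inv_metric {x : Fin 4 → ℝ} (hx : x ∈ chartDomain rH) :
    (h.metric x)⁻¹ = h.metricInv x :=
  h.inv_metric x (hs.posN _ hx.1 _).ne' (hs.posA _ hx.1 _).ne' (hs.posB _ hx.1 _).ne'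
    (h0.trans_lt hx.1).ne' (Real.sin_pos_of_mem_Ioo hx.2).ne'

theorem IsSpacetime.gradientDensity_eqOn (f : ℝ → ℝ → ℝ) (m : Fin 4) :
    EqOn (gradientDensity h.metric (onChart f) m)
      (onChart (![fun _ _ => 0, fun r θ => h.radialFlux f r θ * Real.sin θ, h.angularFlux f,
        fun _ _ => 0] m)) (chartDomain rH) := by
  intro x hx
  have hN := (hs.posN _ hx.1 (x 2)).ne'
  have hA := (hs.posA _ hx.1 (x 2)).ne'
  have hB := (hs.posB _ hx.1 (x 2)).ne'
  have hr := (h0.trans_lt hx.1).ne'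
  rw [gradientDensity, hs.inv_metric h0 hx, hs.sqrt_abs_det_metric h0 hx]
  fin_cases m <;>
    simp [Fin.sum_univ_succ, metricInv, pd, onChart, volumeDensity, radialFlux,
      radialCoeff, angularFlux, angularCoeff] <;>
    field_simp

theorem IsSpacetime.box_onChart (f : ℝ → ℝ → ℝ) (t φ : ℝ) {r θ : ℝ} (hr : rH < r)
    (hθ : θ ∈ Ioo 0 Real.pi) :
    box h.metric (onChart f) ![t, r, θ, φ] = (h.volumeDensity r θ)⁻¹ * h.waveOp f r θ := by
  have hx : ![t, r, θ, φ] ∈ chartDomain rH := ⟨hr, hθ⟩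
  rw [box_eq_divergence, hs.sqrt_abs_det_metric h0 hx]
  simp only [pd_congr (isOpen_chartDomain rH) (hs.gradientDensity_eqOn h0 f _) _ hx]
  simp [Fin.sum_univ_four, pd, onChart, waveOp]

end

end MetricFunctions

/-! ### Reflection in the equatorial plane -/

/-- The reflection `θ ↦ π - θ` of the chart. -/
def reflect (x : Fin 4 → ℝ) : Fin 4 → ℝ := Function.update x 2 (Real.pi - x 2)

/-- The eigenvalue of the coordinate direction `∂_μ` under the reflection. -/
def reflectSign : Fin 4 → ℝ := ![1, 1, -1, 1]

/-- A function on the chart is multiplied by `c` under the reflection of points of `U`. A component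
of an invariant tensor has as parity the product of the signs of its indices. -/
def HasParityOn (U : Set (Fin 4 → ℝ)) (c : ℝ) (f : (Fin 4 → ℝ) → ℝ) : Prop :=
  ∀ x ∈ U, f (reflect x) = c * f x

theorem reflectSign_mul_self (m : Fin 4) : reflectSign m * reflectSign m = 1 := by
  fin_cases m <;> simp [reflectSign]

namespace HasParityOn

variable {U : Set (Fin 4 → ℝ)} {c d : ℝ} {f g : (Fin 4 → ℝ) → ℝ}

theorem add (hf : HasParityOn U c f) (hg : HasParityOn U c g) :
    HasParityOn U c fun x => f x + g x := fun x hx => by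
  simp only [hf x hx, hg x hx, mul_add]

theorem mul (hf : HasParityOn U c f) (hg : HasParityOn U d g) :
    HasParityOn U (c * d) fun x => f x * g x := fun x hx => by
  simp only [hf x hx, hg x hx, mul_mul_mul_comm]

theorem const_mul (a : ℝ) (hf : HasParityOn U c f) : HasParityOn U c fun x => a * f x :=
  fun x hx => by simp only [hf x hx, mul_left_comm]

theorem sub (hf : HasParityOn U c f) (hg : HasParityOn U c g) :
    HasParityOn U c fun x => f x - g x := fun x hx => by
  simp only [hf x hx, hg x hx, mul_sub]

theorem sum {ι : Type*} [Fintype ι] {f : ι → (Fin 4 → ℝ) → ℝ}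
    (hf : ∀ i, HasParityOn U c (f i)) : HasParityOn U c fun x => ∑ i, f i x := fun x hx => by
  simp only [Finset.mul_sum, hf _ x hx]

theorem pd (hU : IsOpen U) (hf : HasParityOn U c f) (m : Fin 4) :
    HasParityOn U (reflectSign m * c) (pd m f) := fun x hx => by
  calc SGB.pd m f (reflect x) = reflectSign m * SGB.pd m (fun y => f (reflect y)) x := by
        by_cases hm : m = 2
        · subst hm
          have := deriv_comp_const_sub (f := fun s => f (Function.update x 2 s)) Real.pi (x 2)
          simp [SGB.pd, reflect, reflectSign, this]
        · have hupd : ∀ s,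
              reflect (Function.update x m s) = Function.update (reflect x) m s := fun s => by
            rw [reflect, reflect, Function.update_comm hm, Function.update_of_ne (Ne.symm hm)]
          have hsign : reflectSign m = 1 := by fin_cases m <;> simp_all [reflectSign]
          have hxm : reflect x m = x m := Function.update_of_ne hm _ _
          simp only [SGB.pd, hupd, hsign, hxm, one_mul]
    _ = reflectSign m * c * SGB.pd m f x := by
        rw [pd_congr hU hf m hx, mul_assoc]
        congr 1
        exact deriv_const_mul_field c

end HasParityOn

section

variable {U : Set (Fin 4 → ℝ)} {g : MetricField}

theorem hasParityOn_inv
    (hg : ∀ a b, HasParityOn U (reflectSign a * reflectSign b) fun x => g x a b) (a b : Fin 4) :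
    HasParityOn U (reflectSign a * reflectSign b) fun x => (g x)⁻¹ a b := by
  intro x hx
  have hD : Matrix.diagonal reflectSign * Matrix.diagonal reflectSign = 1 := by
    simp [Matrix.diagonal_mul_diagonal, reflectSign_mul_self]
  have hgD : g (reflect x) = Matrix.diagonal reflectSign * g x * Matrix.diagonal reflectSign := by
    ext a b
    rw [Matrix.mul_diagonal, Matrix.diagonal_mul, mul_right_comm]
    exact hg a b x hx
  beta_reduce
  rw [hgD, Matrix.mul_inv_rev, Matrix.mul_inv_rev, Matrix.inv_eq_right_inv hD, ← mul_assoc,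
    Matrix.mul_diagonal, Matrix.diagonal_mul, mul_right_comm]

theorem hasParityOn_christoffel (hU : IsOpen U)
    (hg : ∀ a b, HasParityOn U (reflectSign a * reflectSign b) fun x => g x a b) (l m n : Fin 4) :
    HasParityOn U (reflectSign l * reflectSign m * reflectSign n) (christoffel g l m n) := by
  have hpd : ∀ k a b, HasParityOn U (reflectSign k * (reflectSign a * reflectSign b))
      (pd k fun y => g y a b) := fun k a b => (hg a b).pd hU k
  refine .const_mul _ (.sum fun s => ?_)
  have h1 := hpd m s n
  have h2 := hpd n s m
  have h3 := hpd s m n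
  rw [show reflectSign m * (reflectSign s * reflectSign n) =
    reflectSign s * (reflectSign m * reflectSign n) by ring] at h1
  rw [show reflectSign n * (reflectSign s * reflectSign m) =
    reflectSign s * (reflectSign m * reflectSign n) by ring] at h2
  convert (hasParityOn_inv hg l s).mul ((h1.add h2).sub h3) using 1
  linear_combination
    -(reflectSign l * reflectSign m * reflectSign n) * reflectSign_mul_self s

theorem hasParityOn_riemann (hU : IsOpen U)
    (hg : ∀ a b, HasParityOn U (reflectSign a * reflectSign b) fun x => g x a b)
    (a b m n : Fin 4) :
    HasParityOn U (reflectSign a * reflectSign b * reflectSign m * reflectSign n)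
      (riemann g a b m n) := by
  have hΓ := hasParityOn_christoffel hU hg
  have hpd : ∀ j k, HasParityOn U (reflectSign a * reflectSign b * reflectSign j * reflectSign k)
      (pd j (christoffel g a k b)) := fun j k => by
    convert (hΓ a k b).pd hU j using 1
    ring
  have hΓΓ : ∀ j k l, HasParityOn U
      (reflectSign a * reflectSign b * reflectSign j * reflectSign k)
      fun x => christoffel g a j l x * christoffel g l k b x := fun j k l => by
    convert (hΓ a j l).mul (hΓ l k b) using 1
    linear_combination -(reflectSign a * reflectSign b * reflectSign j * reflectSign k) *
      reflectSign_mul_self l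
  have hswap : reflectSign a * reflectSign b * reflectSign n * reflectSign m =
      reflectSign a * reflectSign b * reflectSign m * reflectSign n := by ring
  exact .add (.sub (hpd m n) (hswap ▸ hpd n m)) (.sum fun l => .sub (hΓΓ m n l) (hswap ▸ hΓΓ n m l))

theorem hasParityOn_ricci (hU : IsOpen U)
    (hg : ∀ a b, HasParityOn U (reflectSign a * reflectSign b) fun x => g x a b) (b n : Fin 4) :
    HasParityOn U (reflectSign b * reflectSign n) (ricci g b n) := .sum fun a => by
  convert hasParityOn_riemann hU hg a b a n using 1
  linear_combination -(reflectSign b * reflectSign n) * reflectSign_mul_self a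

theorem hasParityOn_gaussBonnet (hU : IsOpen U)
    (hg : ∀ a b, HasParityOn U (reflectSign a * reflectSign b) fun x => g x a b) :
    HasParityOn U 1 (gaussBonnet g) := by
  have hsq : ∀ m, reflectSign m ^ 2 = 1 := fun m => (sq _).trans (reflectSign_mul_self m)
  have hinv := hasParityOn_inv hg
  have hRic := hasParityOn_ricci hU hg
  have hRiem := hasParityOn_riemann hU hg
  have hscalar : HasParityOn U 1 (ricciScalar g) := .sum fun b => .sum fun n => by
    convert (hinv b n).mul (hRic b n) using 1
    ring_nf
    simp only [hsq, one_mul]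
  have hricciSq : HasParityOn U 1 (ricciSq g) :=
    .sum fun a => .sum fun b => .sum fun c => .sum fun d => by
      convert (((hinv a c).mul (hinv b d)).mul (hRic a b)).mul (hRic c d) using 1
      ring_nf
      simp only [hsq, one_mul]
  have hriemannSq : HasParityOn U 1 (riemannSq g) :=
    .sum fun a => .sum fun b => .sum fun c => .sum fun d => .sum fun e => .sum fun f =>
      .sum fun p => .sum fun q => by
        convert (((((hg a e).mul (hinv b f)).mul (hinv c p)).mul (hinv d q)).mul
          (hRiem a b c d)).mul (hRiem e f p q) using 1
        ring_nf
        simp only [hsq, one_mul]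
  have hscalarSq : HasParityOn U 1 fun x => ricciScalar g x ^ 2 := by
    simpa only [mul_one, sq] using hscalar.mul hscalar
  exact (hscalarSq.sub (hricciSq.const_mul 4)).add hriemannSq

end

namespace MetricFunctions

variable {h : MetricFunctions} {rH : ℝ}

theorem IsReflectionSymmetric.eq_of_mem_Ioo (hrefl : h.IsReflectionSymmetric rH) (h0 : 0 ≤ rH)
    (hs : h.IsSpacetime rH) {r θ : ℝ} (hr : rH < r) (hθ : θ ∈ Ioo 0 Real.pi) :
    h.N r (Real.pi - θ) = h.N r θ ∧ h.A r (Real.pi - θ) = h.A r θ ∧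
      h.B r (Real.pi - θ) = h.B r θ ∧ h.ω r (Real.pi - θ) = h.ω r θ := by
  have hr0 : r ≠ 0 := (h0.trans_lt hr).ne'
  have hsin := (Real.sin_pos_of_mem_Ioo hθ).ne'
  have hcomp : ∀ a b, h.metric ![0, r, θ, 0] a b = h.metric ![0, r, Real.pi - θ, 0] a b :=
    fun a b => by rw [hrefl 0 0 r hr θ hθ]
  have hrr := hcomp 1 1
  have hθθ := hcomp 2 2
  have htφ := hcomp 0 3
  have htt := hcomp 0 0
  simp only [metric, Matrix.of_apply, Matrix.cons_val_one, Matrix.cons_val_zero, Matrix.cons_val,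
    Real.sin_pi_sub] at hrr hθθ htφ htt
  have hA : h.A r (Real.pi - θ) = h.A r θ :=
    ((sq_eq_sq₀ (hs.posA r hr _).le (hs.posA r hr _).le).1 hrr).symm
  have hB : h.B r (Real.pi - θ) = h.B r θ :=
    ((sq_eq_sq₀ (hs.posB r hr _).le (hs.posB r hr _).le).1
      (mul_left_cancel₀ (pow_ne_zero 2 hr0) hθθ)).symm
  have hω : h.ω r (Real.pi - θ) = h.ω r θ := by
    have hB0 := (hs.posB r hr θ).ne'
    rw [hB] at htφ
    exact (mul_left_cancel₀ (neg_ne_zero.2 (by positivity)) htφ).symm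
  refine ⟨((sq_eq_sq₀ (hs.posN r hr _).le (hs.posN r hr _).le).1 ?_).symm, hA, hB, hω⟩
  rw [hB, hω] at htt
  linarith

theorem IsReflectionSymmetric.hasParityOn_metric (hrefl : h.IsReflectionSymmetric rH)
    (h0 : 0 ≤ rH) (hs : h.IsSpacetime rH) (a b : Fin 4) :
    HasParityOn (chartDomain rH) (reflectSign a * reflectSign b) fun x => h.metric x a b := by
  intro x hx
  obtain ⟨hN, hA, hB, hω⟩ := hrefl.eq_of_mem_Ioo h0 hs hx.1 hx.2
  fin_cases a <;> fin_cases b <;> simp [metric, reflect, reflectSign, hN, hA, hB, hω]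

theorem IsReflectionSymmetric.gaussBonnet_pi_sub (hrefl : h.IsReflectionSymmetric rH)
    (h0 : 0 ≤ rH) (hs : h.IsSpacetime rH) (t φ : ℝ) {r θ : ℝ} (hr : rH < r)
    (hθ : θ ∈ Ioo 0 Real.pi) :
    gaussBonnet h.metric ![t, r, Real.pi - θ, φ] = gaussBonnet h.metric ![t, r, θ, φ] := by
  have hreflect : reflect ![t, r, θ, φ] = ![t, r, Real.pi - θ, φ] := by
    ext i; fin_cases i <;> simp [reflect]
  rw [← hreflect, hasParityOn_gaussBonnet (isOpen_chartDomain rH)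
    (hrefl.hasParityOn_metric h0 hs) _ ⟨hr, hθ⟩, one_mul]

end MetricFunctions

/-! ### Integrals depending on a parameter and Hadamard's lemma -/

section Parametric

variable {a b : ℝ}

theorem aestronglyMeasurable_of_continuousOn_uIcc {E : Type*} [NormedAddCommGroup E] {f : ℝ → E}
    (hf : ContinuousOn f (uIcc a b)) :
    MeasureTheory.AEStronglyMeasurable f (MeasureTheory.volume.restrict (uIoc a b)) :=
  (intervalIntegrable_iff.1 hf.intervalIntegrable).aestronglyMeasurable

theorem continuousOn_slice {X Y Z : Type*} [TopologicalSpace X] [TopologicalSpace Y]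
    [TopologicalSpace Z] {K : X → Y → Z} {p : X} {S : Set Y}
    (hK : ∀ s ∈ S, ContinuousAt (Function.uncurry K) (p, s)) : ContinuousOn (K p) S := fun s hs =>
  ((hK s hs).comp (f := fun s => (p, s)) (by fun_prop)).continuousWithinAt

theorem exists_eventually_norm_le {X Y E : Type*} [TopologicalSpace X] [TopologicalSpace Y]
    [SeminormedAddCommGroup E] {K : X → Y → E} {p : X} {S : Set Y} (hS : IsCompact S)
    (hK : ∀ s ∈ S, ContinuousAt (Function.uncurry K) (p, s)) :
    ∃ C, ∀ᶠ x in 𝓝 p, ∀ s ∈ S, ‖K x s‖ ≤ C := by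
  obtain ⟨C, hC⟩ := hS.exists_bound_of_continuousOn (continuousOn_slice hK)
  refine ⟨C + 1, hS.eventually_forall_of_forall_eventually fun s hs => ?_⟩
  filter_upwards [(hK s hs).norm.eventually_lt_const ((hC s hs).trans_lt (lt_add_one C))]
    with q hq using hq.le

theorem continuousAt_intervalIntegral {X E : Type*} [TopologicalSpace X]
    [FirstCountableTopology X] [NormedAddCommGroup E] [NormedSpace ℝ E] {K : X → ℝ → E} {p : X}
    (hK : ∀ᶠ x in 𝓝 p, ∀ s ∈ uIcc a b, ContinuousAt (Function.uncurry K) (x, s)) :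
    ContinuousAt (fun x => ∫ s in a..b, K x s) p := by
  obtain ⟨C, hC⟩ := exists_eventually_norm_le isCompact_uIcc hK.self_of_nhds
  refine intervalIntegral.continuousAt_of_dominated_interval (bound := fun _ => C) ?_ ?_
    intervalIntegrable_const ?_
  · filter_upwards [hK] with x hx
      using aestronglyMeasurable_of_continuousOn_uIcc (continuousOn_slice hx)
  · filter_upwards [hC] with x hx using .of_forall fun s hs => hx s (uIoc_subset_uIcc hs)
  · exact .of_forall fun s hs => (hK.self_of_nhds s (uIoc_subset_uIcc hs)).comp
      (f := fun x => (x, s)) (by fun_prop)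

variable {H E : Type*} [NormedAddCommGroup H] [NormedSpace ℝ H] [NormedAddCommGroup E]
  [NormedSpace ℝ E] {K : H → ℝ → E} {p : H}

theorem eventually_forall_contDiffAt {n : WithTop ℕ∞} (hn : n ≠ (⊤ : ℕ∞))
    (hK : ∀ s ∈ uIcc a b, ContDiffAt ℝ n (Function.uncurry K) (p, s)) :
    ∀ᶠ x in 𝓝 p, ∀ s ∈ uIcc a b, ContDiffAt ℝ n (Function.uncurry K) (x, s) :=
  isCompact_uIcc.eventually_forall_of_forall_eventually fun s hs => (hK s hs).eventually hn

theorem hasFDerivAt_intervalIntegral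
    (hK : ∀ s ∈ uIcc a b, ContDiffAt ℝ 1 (Function.uncurry K) (p, s)) :
    HasFDerivAt (fun x => ∫ s in a..b, K x s)
      (∫ s in a..b, (fderiv ℝ (Function.uncurry K) (p, s)).comp (ContinuousLinearMap.inl ℝ H ℝ))
      p := by
  have hKev := eventually_forall_contDiffAt (by simp) hK
  have hK' : ∀ s ∈ uIcc a b, ContinuousAt (Function.uncurry fun x s =>
      (fderiv ℝ (Function.uncurry K) (x, s)).comp (ContinuousLinearMap.inl ℝ H ℝ)) (p, s) :=
    fun s hs => ((hK s hs).continuousAt_fderiv one_ne_zero).clm_comp continuousAt_const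
  obtain ⟨C, hC⟩ := exists_eventually_norm_le isCompact_uIcc hK'
  obtain ⟨ε, hε, hball⟩ := Metric.eventually_nhds_iff_ball.1 (hKev.and hC)
  refine intervalIntegral.hasFDerivAt_integral_of_dominated_of_fderiv_le (bound := fun _ => C)
    (Metric.ball_mem_nhds p hε) ?_ (continuousOn_slice fun s hs =>
      (hK s hs).continuousAt).intervalIntegrable
    (aestronglyMeasurable_of_continuousOn_uIcc (continuousOn_slice hK'))
    (.of_forall fun s hs x hx => (hball x hx).2 s (uIoc_subset_uIcc hs)) intervalIntegrable_const
    (.of_forall fun s hs x hx => ?_)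
  · filter_upwards [hKev] with x hx using aestronglyMeasurable_of_continuousOn_uIcc
      (continuousOn_slice fun s hs => (hx s hs).continuousAt)
  · exact (((hball x hx).1 s (uIoc_subset_uIcc hs)).differentiableAt
      one_ne_zero).hasFDerivAt.comp (f := fun x => (x, s)) x (hasFDerivAt_prodMk_left x s)

theorem hasDerivAt_intervalIntegral {E : Type*} [NormedAddCommGroup E] [NormedSpace ℝ E]
    {K : ℝ → ℝ → E} {r : ℝ}
    (hK : ∀ s ∈ uIcc a b, ContDiffAt ℝ 1 (Function.uncurry K) (r, s)) :
    HasDerivAt (fun x => ∫ s in a..b, K x s) (∫ s in a..b, deriv (fun x => K x s) r) r := by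
  have hint : IntervalIntegrable (fun s => (fderiv ℝ (Function.uncurry K) (r, s)).comp
      (ContinuousLinearMap.inl ℝ ℝ ℝ)) MeasureTheory.volume a b :=
    ContinuousOn.intervalIntegrable fun s hs => (((hK s hs).continuousAt_fderiv one_ne_zero).comp
      (f := fun s => (r, s)) (by fun_prop)).continuousWithinAt.clm_comp continuousWithinAt_const
  have hderiv := (hasFDerivAt_intervalIntegral hK).hasDerivAt
  rw [ContinuousLinearMap.intervalIntegral_apply hint] at hderiv
  refine hderiv.congr_deriv (intervalIntegral.integral_congr fun s hs => ?_)
  have hcomp := ((hK s hs).differentiableAt one_ne_zero).hasFDerivAt.comp (f := fun x => (x, s)) r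
    (hasFDerivAt_prodMk_left r s)
  exact hcomp.hasDerivAt.deriv.symm

end Parametric

section Hadamard

universe u

variable {H E : Type u} [NormedAddCommGroup H] [NormedSpace ℝ H] [NormedAddCommGroup E]
  [NormedSpace ℝ E]

-- `H` and `E` share a universe because the induction replaces `E` by `H →L[ℝ] E`.
theorem contDiffAt_intervalIntegral {n : ℕ} {a b : ℝ} {K : H → ℝ → E} {p : H}
    (hK : ∀ s ∈ uIcc a b, ContDiffAt ℝ n (Function.uncurry K) (p, s)) :
    ContDiffAt ℝ n (fun x => ∫ s in a..b, K x s) p := by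
  induction n generalizing E with
  | zero =>
    have hcont := (eventually_forall_contDiffAt (by simp) hK).eventually_nhds.mono fun x hx =>
      continuousAt_intervalIntegral (hx.mono fun y hy s hs => (hy s hs).continuousAt)
    exact contDiffAt_zero.2 ⟨_, hcont, fun x hx => ContinuousAt.continuousWithinAt hx⟩
  | succ n ih =>
    have hderiv := (eventually_forall_contDiffAt (by simp) hK).mono fun x hx =>
      hasFDerivAt_intervalIntegral fun s hs => (hx s hs).of_le (by simp)
    refine contDiffAt_succ_iff_hasFDerivAt.2 ⟨_, ⟨_, hderiv, fun x hx => hx⟩, ih fun s hs => ?_⟩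
    exact ((hK s hs).fderiv_right (by simp)).clm_comp contDiffAt_const

theorem exists_contDiffAt_smul_eq_sub [CompleteSpace E] {F : ℝ × H → E} {y : H}
    (hF : ContDiffAt ℝ (⊤ : ℕ∞) F (0, y)) :
    ∃ G : ℝ × H → E, ContDiffAt ℝ (⊤ : ℕ∞) G (0, y) ∧
      ∀ᶠ p in 𝓝 ((0 : ℝ), y), F p - F (0, p.2) = p.1 • G p := by
  let K : ℝ × H → ℝ → E := fun p s => fderiv ℝ F (s * p.1, p.2) (1, 0)
  have hscale : ∀ s : ℝ, ContDiffAt ℝ (⊤ : ℕ∞)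
      (fun q : (ℝ × H) × ℝ => (q.2 * q.1.1, q.1.2)) ((0, y), s) := fun s => by fun_prop
  have hK : ∀ s ∈ uIcc (0 : ℝ) 1,
      ContDiffAt ℝ (⊤ : ℕ∞) (Function.uncurry K) ((0, y), s) := fun s _ => by
    have hdF : ContDiffAt ℝ (⊤ : ℕ∞) (fderiv ℝ F) (s * 0, y) :=
      (mul_zero s).symm ▸ hF.fderiv_right (by simp)
    exact (hdF.comp ((0, y), s) (hscale s)).clm_apply contDiffAt_const
  have hKn (n : ℕ) : ∀ s ∈ uIcc (0 : ℝ) 1,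
      ContDiffAt ℝ n (Function.uncurry K) ((0, y), s) := fun s hs =>
    (hK s hs).of_le (by exact_mod_cast le_top)
  have hdiff : ∀ᶠ p in 𝓝 ((0 : ℝ), y), ∀ s ∈ uIcc (0 : ℝ) 1,
      DifferentiableAt ℝ F (s * p.1, p.2) := by
    refine isCompact_uIcc.eventually_forall_of_forall_eventually fun s _ => ?_
    have hev : ∀ᶠ q in 𝓝 (s * 0, y), DifferentiableAt ℝ F q := by
      rw [mul_zero]
      exact ((hF.of_le (m := 1) (by simp)).eventually (by simp)).mono fun q hq =>
        hq.differentiableAt one_ne_zero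
    exact (hscale s).continuousAt.eventually hev
  refine ⟨fun p => ∫ s in (0 : ℝ)..1, K p s,
    contDiffAt_infty.2 fun n => contDiffAt_intervalIntegral (hKn n), ?_⟩
  filter_upwards [hdiff, eventually_forall_contDiffAt (by simp) (hKn 0)] with p hFp hKp
  have hline : ∀ s ∈ uIcc (0 : ℝ) 1,
      HasDerivAt (fun s => F (s * p.1, p.2)) (p.1 • K p s) s := fun s hs => by
    have hlin : HasDerivAt (fun s : ℝ => (s * p.1, p.2)) (p.1 • ((1 : ℝ), (0 : H))) s := by
      simpa using ((hasDerivAt_id s).mul_const p.1).prodMk (hasDerivAt_const s p.2)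
    have hcomp := (hFp s hs).hasFDerivAt.comp_hasDerivAt s hlin
    rwa [map_smul] at hcomp
  have hint := (continuousOn_slice fun s hs => (hKp s hs).continuousAt).const_smul p.1
  have hftc := intervalIntegral.integral_eq_sub_of_hasDerivAt hline hint.intervalIntegrable
  simpa using hftc.symm

end Hadamard

/-! ### Partial derivatives of functions of two variables -/

section Partial

variable {f : ℝ → ℝ → ℝ} {U : Set (ℝ × ℝ)} {m n : WithTop ℕ∞}

theorem hasDerivAt_fst (hU : IsOpen U) (hn : n ≠ 0)
    (hf : ContDiffOn ℝ n (fun p : ℝ × ℝ => f p.1 p.2) U) {x y : ℝ} (hp : (x, y) ∈ U) :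
    HasDerivAt (fun s => f s y) (fderiv ℝ (fun p : ℝ × ℝ => f p.1 p.2) (x, y) (1, 0)) x := by
  have hfderiv := ((hf.differentiableOn hn).differentiableAt (hU.mem_nhds hp)).hasFDerivAt
  exact hfderiv.comp_hasDerivAt x ((hasDerivAt_id x).prodMk (hasDerivAt_const x y))

theorem hasDerivAt_snd (hU : IsOpen U) (hn : n ≠ 0)
    (hf : ContDiffOn ℝ n (fun p : ℝ × ℝ => f p.1 p.2) U) {x y : ℝ} (hp : (x, y) ∈ U) :
    HasDerivAt (f x) (fderiv ℝ (fun p : ℝ × ℝ => f p.1 p.2) (x, y) (0, 1)) y := by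
  have hfderiv := ((hf.differentiableOn hn).differentiableAt (hU.mem_nhds hp)).hasFDerivAt
  exact hfderiv.comp_hasDerivAt y ((hasDerivAt_const y x).prodMk (hasDerivAt_id y))

theorem contDiffOn_deriv_fst (hU : IsOpen U) (hmn : m + 1 ≤ n)
    (hf : ContDiffOn ℝ n (fun p : ℝ × ℝ => f p.1 p.2) U) :
    ContDiffOn ℝ m (fun p : ℝ × ℝ => deriv (fun s => f s p.2) p.1) U := by
  have hn : n ≠ 0 := by rintro rfl; simp at hmn
  exact ((hf.fderiv_of_isOpen hU hmn).clm_apply contDiffOn_const).congr fun p hp =>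
    (hasDerivAt_fst hU hn hf hp).deriv

theorem contDiffOn_deriv_snd (hU : IsOpen U) (hmn : m + 1 ≤ n)
    (hf : ContDiffOn ℝ n (fun p : ℝ × ℝ => f p.1 p.2) U) :
    ContDiffOn ℝ m (fun p : ℝ × ℝ => deriv (f p.1) p.2) U := by
  have hn : n ≠ 0 := by rintro rfl; simp at hmn
  exact ((hf.fderiv_of_isOpen hU hmn).clm_apply contDiffOn_const).congr fun p hp =>
    (hasDerivAt_snd hU hn hf hp).deriv

theorem differentiableAt_fst (hU : IsOpen U) (hn : n ≠ 0)
    (hf : ContDiffOn ℝ n (fun p : ℝ × ℝ => f p.1 p.2) U) {x y : ℝ} (hp : (x, y) ∈ U) :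
    DifferentiableAt ℝ (fun s => f s y) x :=
  (hasDerivAt_fst hU hn hf hp).differentiableAt

theorem differentiableAt_snd (hU : IsOpen U) (hn : n ≠ 0)
    (hf : ContDiffOn ℝ n (fun p : ℝ × ℝ => f p.1 p.2) U) {x y : ℝ} (hp : (x, y) ∈ U) :
    DifferentiableAt ℝ (f x) y :=
  (hasDerivAt_snd hU hn hf hp).differentiableAt

theorem continuous_of_continuousOn_prod {F : ℝ × ℝ → ℝ} (hF : ContinuousOn F U) {r : ℝ}
    (hr : ∀ θ, (r, θ) ∈ U) : Continuous fun θ => F (r, θ) :=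
  continuousOn_univ.1 (hF.comp (by fun_prop) fun θ _ => hr θ)

end Partial

/-! ### Functions regular on the axis -/

theorem eq_arccos_cos_of_even_periodic {X : Type*} {f : ℝ → X} (heven : f.Even)
    (hper : f.Periodic (2 * Real.pi)) (θ : ℝ) : f θ = f (Real.arccos (Real.cos θ)) := by
  obtain ⟨k, hk | hk⟩ := Real.cos_eq_cos_iff.1
    (Real.cos_arccos (Real.neg_one_le_cos θ) (Real.cos_le_one θ))
  · calc f θ = f (Real.arccos (Real.cos θ) + k * (2 * Real.pi)) := by congr 1; linarith
      _ = f (Real.arccos (Real.cos θ)) := hper.int_mul k _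
  · calc f θ = f (-Real.arccos (Real.cos θ) + k * (2 * Real.pi)) := by congr 1; linarith
      _ = f (-Real.arccos (Real.cos θ)) := hper.int_mul k _
      _ = f (Real.arccos (Real.cos θ)) := heven _

theorem eq_of_even_periodic {X : Type*} [TopologicalSpace X] [T2Space X] {f g : ℝ → X}
    (hf : Continuous f) (hg : Continuous g) (hfeven : f.Even) (hfper : f.Periodic (2 * Real.pi))
    (hgeven : g.Even) (hgper : g.Periodic (2 * Real.pi)) (hfg : EqOn f g (Ioo 0 Real.pi)) :
    f = g := by
  have hIcc : EqOn f g (Icc 0 Real.pi) := closure_Ioo Real.pi_pos.ne ▸ hfg.closure hf hg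
  funext θ
  rw [eq_arccos_cos_of_even_periodic hfeven hfper, eq_arccos_cos_of_even_periodic hgeven hgper]
  exact hIcc ⟨Real.arccos_nonneg _, Real.arccos_le_pi _⟩

theorem isOpen_outside (rH : ℝ) : IsOpen (Ioi rH ×ˢ (univ : Set ℝ)) := isOpen_Ioi.prod isOpen_univ

namespace IsRegularOutside

variable {rH : ℝ} {f g : ℝ → ℝ → ℝ}

theorem continuous (hf : IsRegularOutside rH f) {r : ℝ} (hr : rH < r) : Continuous (f r) :=
  continuous_of_continuousOn_prod hf.contDiffOn.continuousOn fun _ => ⟨hr, trivial⟩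

theorem comp_pi_sub (hf : IsRegularOutside rH f) :
    IsRegularOutside rH fun r θ => f r (Real.pi - θ) where
  contDiffOn := hf.contDiffOn.comp (f := fun p : ℝ × ℝ => (p.1, Real.pi - p.2)) (by fun_prop)
    fun p hp => ⟨hp.1, trivial⟩
  even r hr θ := by
    rw [← hf.even r hr, ← hf.periodic r hr]
    congr 1; ring
  periodic r hr θ := by
    rw [← hf.periodic r hr]
    congr 1; ring

theorem add (hf : IsRegularOutside rH f) (hg : IsRegularOutside rH g) :
    IsRegularOutside rH fun r θ => f r θ + g r θ where
  contDiffOn := hf.contDiffOn.add hg.contDiffOn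
  even r hr θ := by rw [hf.even r hr, hg.even r hr]
  periodic r hr θ := by rw [hf.periodic r hr, hg.periodic r hr]

theorem neg (hf : IsRegularOutside rH f) : IsRegularOutside rH fun r θ => -f r θ where
  contDiffOn := hf.contDiffOn.neg
  even r hr θ := by rw [hf.even r hr]
  periodic r hr θ := by rw [hf.periodic r hr]

theorem eq_of_eqOn_Ioo (hf : IsRegularOutside rH f) (hg : IsRegularOutside rH g) {r : ℝ}
    (hr : rH < r) (hfg : EqOn (f r) (g r) (Ioo 0 Real.pi)) : f r = g r :=
  eq_of_even_periodic (hf.continuous hr) (hg.continuous hr) (hf.even r hr) (hf.periodic r hr)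
    (hg.even r hr) (hg.periodic r hr) hfg

end IsRegularOutside

/-! ### The energy identity and uniqueness -/

namespace MetricFunctions

/-- The flux of `χ ∇χ` through the sphere of radius `r`. -/
def energyFlux (h : MetricFunctions) (χ : ℝ → ℝ → ℝ) (r : ℝ) : ℝ :=
  ∫ θ in (0 : ℝ)..Real.pi, h.radialFlux χ r θ * χ r θ * Real.sin θ

/-- The density of the Dirichlet energy of `χ`. -/
def energyDensity (h : MetricFunctions) (χ : ℝ → ℝ → ℝ) (r θ : ℝ) : ℝ :=
  h.radialFlux χ r θ * deriv (fun s => χ s θ) r * Real.sin θ +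
    h.angularFlux χ r θ * deriv (χ r) θ

theorem energyDensity_eq (h : MetricFunctions) (χ : ℝ → ℝ → ℝ) (r θ : ℝ) :
    h.energyDensity χ r θ = (h.radialCoeff r θ * deriv (fun s => χ s θ) r ^ 2 +
      h.angularCoeff r θ * deriv (χ r) θ ^ 2) * Real.sin θ := by
  unfold energyDensity radialFlux angularFlux
  ring

theorem inner_nonneg {h : MetricFunctions} {rH : ℝ}
    (hinner : h.IsBlackHole rH ∨ h.IsNeutronStar rH) : 0 ≤ rH :=
  hinner.elim (fun hb => hb.pos.le) fun hn => hn.zero.ge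

theorem tendsto_energyFlux {h : MetricFunctions} {χ : ℝ → ℝ → ℝ} {l : Filter ℝ}
    (hlim : Tendsto (fun p : ℝ × ℝ => h.radialFlux χ p.1 p.2 * χ p.1 p.2)
      (l ×ˢ 𝓟 (Icc 0 Real.pi)) (𝓝 0)) :
    Tendsto (h.energyFlux χ) l (𝓝 0) := by
  rw [Metric.tendsto_nhds] at hlim ⊢
  intro ε hε
  have hε' : 0 < ε / (2 * Real.pi) := by have := Real.pi_pos; positivity
  filter_upwards [eventually_prod_principal_iff.1 (hlim _ hε')] with r hr
  have hbound := intervalIntegral.norm_integral_le_of_norm_le_const (a := 0) (b := Real.pi)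
    (C := ε / (2 * Real.pi)) (f := fun θ => h.radialFlux χ r θ * χ r θ * Real.sin θ)
    fun θ hθ => by
      rw [uIoc_of_le Real.pi_pos.le] at hθ
      rw [norm_mul, ← dist_zero_right]
      exact (mul_le_of_le_one_right dist_nonneg (Real.abs_sin_le_one θ)).trans
        (hr θ ⟨hθ.1.le, hθ.2⟩).le
  calc dist (h.energyFlux χ r) 0 = ‖h.energyFlux χ r‖ := dist_zero_right _
    _ ≤ ε / (2 * Real.pi) * |Real.pi - 0| := hbound
    _ = ε / 2 := by rw [sub_zero, abs_of_pos Real.pi_pos]; field_simp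
    _ < ε := half_lt_self hε

namespace IsSpacetime

variable {h : MetricFunctions} {rH r : ℝ} {χ : ℝ → ℝ → ℝ}

theorem radialCoeff_pos (hs : h.IsSpacetime rH) (h0 : 0 ≤ rH) (hr : rH < r) (θ : ℝ) :
    0 < h.radialCoeff r θ := by
  have hN := hs.posN r hr θ
  have hA := hs.posA r hr θ
  have hB := hs.posB r hr θ
  have hr' : 0 < r := h0.trans_lt hr
  unfold radialCoeff
  positivity

theorem angularCoeff_pos (hs : h.IsSpacetime rH) (hr : rH < r) (θ : ℝ) :
    0 < h.angularCoeff r θ :=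
  mul_pos (hs.posN r hr θ) (hs.posA r hr θ)

theorem contDiffOn_radialFlux (hs : h.IsSpacetime rH) (hχ : IsRegularOutside rH χ) :
    ContDiffOn ℝ 1 (fun p : ℝ × ℝ => h.radialFlux χ p.1 p.2) (Ioi rH ×ˢ univ) := by
  have hcoeff : ContDiffOn ℝ 2 (fun p : ℝ × ℝ => h.radialCoeff p.1 p.2) (Ioi rH ×ˢ univ) :=
    (hs.regN.contDiffOn.mul ((contDiffOn_fst.pow 2).mul (hs.regB.contDiffOn.pow 2))).div
      hs.regA.contDiffOn fun p hp => (hs.posA _ hp.1 _).ne'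
  exact (hcoeff.of_le one_le_two).mul
    (contDiffOn_deriv_fst (isOpen_outside rH) (by norm_num) hχ.contDiffOn)

theorem contDiffOn_angularFlux (hs : h.IsSpacetime rH) (hχ : IsRegularOutside rH χ) :
    ContDiffOn ℝ 1 (fun p : ℝ × ℝ => h.angularFlux χ p.1 p.2) (Ioi rH ×ˢ univ) := by
  have hcoeff : ContDiffOn ℝ 2 (fun p : ℝ × ℝ => h.angularCoeff p.1 p.2 * Real.sin p.2)
      (Ioi rH ×ˢ univ) :=
    (hs.regN.contDiffOn.mul hs.regA.contDiffOn).mul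
      (Real.contDiff_sin.comp contDiff_snd).contDiffOn
  exact (hcoeff.of_le one_le_two).mul
    (contDiffOn_deriv_snd (isOpen_outside rH) (by norm_num) hχ.contDiffOn)

theorem continuous_energyDensity (hs : h.IsSpacetime rH) (hχ : IsRegularOutside rH χ)
    (hr : rH < r) : Continuous (h.energyDensity χ r) := by
  have hmem : ∀ θ : ℝ, (r, θ) ∈ Ioi rH ×ˢ (univ : Set ℝ) := fun θ => ⟨hr, trivial⟩
  have hrad := continuous_of_continuousOn_prod (hs.contDiffOn_radialFlux hχ).continuousOn hmem
  have hang := continuous_of_continuousOn_prod (hs.contDiffOn_angularFlux hχ).continuousOn hmem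
  have hχr := continuous_of_continuousOn_prod
    (contDiffOn_deriv_fst (m := 1) (isOpen_outside rH) (by norm_num)
      hχ.contDiffOn).continuousOn hmem
  have hχθ := continuous_of_continuousOn_prod
    (contDiffOn_deriv_snd (m := 1) (isOpen_outside rH) (by norm_num)
      hχ.contDiffOn).continuousOn hmem
  exact ((hrad.mul hχr).mul Real.continuous_sin).add (hang.mul hχθ)

theorem energyDensity_nonneg (hs : h.IsSpacetime rH) (h0 : 0 ≤ rH) (hr : rH < r) {θ : ℝ}
    (hθ : θ ∈ Icc 0 Real.pi) : 0 ≤ h.energyDensity χ r θ := by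
  have hrad := hs.radialCoeff_pos h0 hr θ
  have hang := hs.angularCoeff_pos hr θ
  have hsin := Real.sin_nonneg_of_mem_Icc hθ
  rw [energyDensity_eq]
  positivity

theorem deriv_eq_zero_of_integral_energyDensity (hs : h.IsSpacetime rH) (h0 : 0 ≤ rH)
    (hχ : IsRegularOutside rH χ) (hr : rH < r)
    (hint : ∫ θ in (0 : ℝ)..Real.pi, h.energyDensity χ r θ = 0) {θ : ℝ}
    (hθ : θ ∈ Ioo 0 Real.pi) : deriv (fun s => χ s θ) r = 0 := by
  have hzero : h.energyDensity χ r θ = 0 := by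
    refine (hs.energyDensity_nonneg h0 hr (Ioo_subset_Icc_self hθ)).eq_of_not_lt' fun hpos => ?_
    exact (intervalIntegral.integral_pos Real.pi_pos
      (hs.continuous_energyDensity hχ hr).continuousOn
      (fun x hx => hs.energyDensity_nonneg h0 hr (Ioc_subset_Icc_self hx))
      ⟨θ, Ioo_subset_Icc_self hθ, hpos⟩).ne' hint
  have hrad := hs.radialCoeff_pos h0 hr θ
  have hang := hs.angularCoeff_pos hr θ
  rw [energyDensity_eq] at hzero
  have hsum := (mul_eq_zero.1 hzero).resolve_right (Real.sin_pos_of_mem_Ioo hθ).ne'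
  have hterm := ((add_eq_zero_iff_of_nonneg (by positivity) (by positivity)).1 hsum).1
  exact pow_eq_zero_iff two_ne_zero |>.1 ((mul_eq_zero.1 hterm).resolve_left hrad.ne')

theorem integral_deriv_angularFlux_mul (hs : h.IsSpacetime rH) (hχ : IsRegularOutside rH χ)
    (hr : rH < r) :
    Continuous (deriv fun θ => h.angularFlux χ r θ * χ r θ) ∧
      ∫ θ in (0 : ℝ)..Real.pi, deriv (fun θ => h.angularFlux χ r θ * χ r θ) θ = 0 := by
  have hmem : ∀ θ : ℝ, (r, θ) ∈ Ioi rH ×ˢ (univ : Set ℝ) := fun θ => ⟨hr, trivial⟩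
  have hprod : ContDiffOn ℝ 1 (fun p : ℝ × ℝ => h.angularFlux χ p.1 p.2 * χ p.1 p.2)
      (Ioi rH ×ˢ univ) :=
    (hs.contDiffOn_angularFlux hχ).mul (hχ.contDiffOn.of_le one_le_two)
  have hcont := continuous_of_continuousOn_prod (contDiffOn_deriv_snd (m := 0)
    (f := fun r θ => h.angularFlux χ r θ * χ r θ) (isOpen_outside rH) (by norm_num)
    hprod).continuousOn hmem
  refine ⟨hcont, ?_⟩
  rw [intervalIntegral.integral_deriv_eq_sub (fun θ _ => differentiableAt_snd
    (f := fun r θ => h.angularFlux χ r θ * χ r θ) (isOpen_outside rH) one_ne_zero hprod (hmem θ))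
    (hcont.intervalIntegrable _ _)]
  simp [angularFlux]

theorem hasDerivAt_energyFlux (hs : h.IsSpacetime rH) (hχ : IsRegularOutside rH χ)
    (heq : ∀ r > rH, ∀ θ ∈ Ioo 0 Real.pi, h.waveOp χ r θ = 0) (hr : rH < r) :
    HasDerivAt (h.energyFlux χ) (∫ θ in (0 : ℝ)..Real.pi, h.energyDensity χ r θ) r := by
  have hU := isOpen_outside rH
  have hmem : ∀ θ : ℝ, (r, θ) ∈ Ioi rH ×ˢ (univ : Set ℝ) := fun θ => ⟨hr, trivial⟩
  have hrad := hs.contDiffOn_radialFlux hχ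
  have hχ₁ := hχ.contDiffOn.of_le (m := 1) one_le_two
  have hK : ContDiffOn ℝ 1 (fun p : ℝ × ℝ => h.radialFlux χ p.1 p.2 * χ p.1 p.2 * Real.sin p.2)
      (Ioi rH ×ˢ univ) := (hrad.mul hχ₁).mul (Real.contDiff_sin.comp contDiff_snd).contDiffOn
  have hKr : Continuous fun θ => deriv (fun s => h.radialFlux χ s θ * χ s θ * Real.sin θ) r :=
    continuous_of_continuousOn_prod (contDiffOn_deriv_fst (m := 0)
      (f := fun r θ => h.radialFlux χ r θ * χ r θ * Real.sin θ) hU (by norm_num)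
      hK).continuousOn hmem
  obtain ⟨hQ, hQ0⟩ := hs.integral_deriv_angularFlux_mul hχ hr
  have hderiv := hasDerivAt_intervalIntegral
    (K := fun r θ => h.radialFlux χ r θ * χ r θ * Real.sin θ) (r := r)
    fun θ (_ : θ ∈ uIcc 0 Real.pi) => hK.contDiffAt (hU.mem_nhds (hmem θ))
  have hsum := intervalIntegral.integral_add (μ := MeasureTheory.volume)
    (hKr.intervalIntegrable 0 Real.pi) (hQ.intervalIntegrable 0 Real.pi)
  rw [hQ0, add_zero] at hsum
  refine hderiv.congr_deriv (hsum.symm.trans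
    (intervalIntegral.integral_congr_Ioo_of_le Real.pi_pos.le fun θ hθ => ?_))
  have hradd := (differentiableAt_fst hU one_ne_zero hrad (hmem θ)).hasDerivAt
  have hangd := (differentiableAt_snd hU one_ne_zero (hs.contDiffOn_angularFlux hχ)
    (hmem θ)).hasDerivAt
  have hχr := (differentiableAt_fst hU one_ne_zero hχ₁ (hmem θ)).hasDerivAt
  have hχθ := (differentiableAt_snd hU one_ne_zero hχ₁ (hmem θ)).hasDerivAt
  have hwave := heq r hr θ hθ
  rw [((hradd.fun_mul hχr).mul_const (Real.sin θ)).deriv, (hangd.fun_mul hχθ).deriv]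
  unfold waveOp at hwave
  unfold energyDensity
  linear_combination χ r θ * hwave

theorem energyFlux_eq_zero (hs : h.IsSpacetime rH) (h0 : 0 ≤ rH) (hχ : IsRegularOutside rH χ)
    (heq : ∀ r > rH, ∀ θ ∈ Ioo 0 Real.pi, h.waveOp χ r θ = 0)
    (hin : Tendsto (h.energyFlux χ) (𝓝[>] rH) (𝓝 0))
    (hout : Tendsto (h.energyFlux χ) atTop (𝓝 0)) (hr : rH < r) : h.energyFlux χ r = 0 := by
  have hder : ∀ s > rH, HasDerivAt (h.energyFlux χ)
      (∫ θ in (0 : ℝ)..Real.pi, h.energyDensity χ s θ) s := fun s hrs =>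
    hs.hasDerivAt_energyFlux hχ heq hrs
  have hmono : MonotoneOn (h.energyFlux χ) (Ioi rH) := by
    refine monotoneOn_of_hasDerivWithinAt_nonneg (convex_Ioi rH)
      (fun s hrs => (hder s hrs).continuousAt.continuousWithinAt)
      (fun s hrs => (hder s (interior_subset hrs)).hasDerivWithinAt) fun s hrs => ?_
    exact intervalIntegral.integral_nonneg Real.pi_pos.le fun θ hθ =>
      hs.energyDensity_nonneg h0 (interior_subset hrs) hθ
  apply le_antisymm
  · refine ge_of_tendsto hout ?_
    filter_upwards [eventually_ge_atTop r] with s hrs using hmono hr (hr.trans_le hrs) hrs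
  · refine le_of_tendsto hin ?_
    filter_upwards [Ioo_mem_nhdsGT hr] with s hrs using hmono hrs.1 hr hrs.2.le

theorem eq_zero_of_tendsto_energyFlux (hs : h.IsSpacetime rH) (h0 : 0 ≤ rH)
    (hχ : IsRegularOutside rH χ)
    (heq : ∀ r > rH, ∀ θ ∈ Ioo 0 Real.pi, h.waveOp χ r θ = 0)
    (hin : Tendsto (h.energyFlux χ) (𝓝[>] rH) (𝓝 0))
    (hout : Tendsto (h.energyFlux χ) atTop (𝓝 0))
    (hlim : ∀ θ ∈ Ioo 0 Real.pi, Tendsto (fun r => χ r θ) atTop (𝓝 0)) :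
    ∀ r > rH, ∀ θ, χ r θ = 0 := by
  have hint : ∀ r > rH, ∫ θ in (0 : ℝ)..Real.pi, h.energyDensity χ r θ = 0 := fun r hr => by
    refine (hs.hasDerivAt_energyFlux hχ heq hr).unique
      ((hasDerivAt_const r (0 : ℝ)).congr_of_eventuallyEq ?_)
    filter_upwards [lt_mem_nhds hr] with s hrs
      using hs.energyFlux_eq_zero h0 hχ heq hin hout hrs
  have hIoo : ∀ r > rH, EqOn (χ r) (fun _ => 0) (Ioo 0 Real.pi) := fun r hr θ hθ => by
    have hconst : ∀ s > rH, χ s θ = χ r θ := fun s hrs =>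
      isOpen_Ioi.is_const_of_deriv_eq_zero isPreconnected_Ioi
        (fun x hx => (differentiableAt_fst (isOpen_outside rH) two_ne_zero hχ.contDiffOn
          ⟨hx, trivial⟩).differentiableWithinAt)
        (fun x hx => hs.deriv_eq_zero_of_integral_energyDensity h0 hχ hx (hint x hx) hθ) hrs hr
    refine tendsto_nhds_unique (tendsto_const_nhds.congr' ?_) (hlim θ hθ)
    filter_upwards [eventually_gt_atTop rH] with s hrs using (hconst s hrs).symm
  exact fun r hr θ => congrFun (eq_of_even_periodic (hχ.continuous hr) continuous_const
    (hχ.even r hr) (hχ.periodic r hr) (fun _ => rfl) (fun _ => rfl) (hIoo r hr)) θ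

end IsSpacetime

/-! ### The inner end -/

theorem tendsto_lapse_mul_area {h : MetricFunctions} {rH : ℝ}
    (hinner : h.IsBlackHole rH ∨ h.IsNeutronStar rH) :
    Tendsto (fun p : ℝ × ℝ => h.N p.1 p.2 * (p.1 ^ 2 * h.B p.1 p.2 ^ 2)) (innerEnd rH) (𝓝 0) := by
  rcases hinner with hb | hn
  · exact ((isBigO_refl _ _).mul hb.area).trans_tendsto (by simpa using hb.lapse)
  · obtain ⟨c, -, hc⟩ := hn.lapse
    obtain ⟨a, -, -, ha⟩ := hn.spatial
    have hfst : Tendsto (fun p : ℝ × ℝ => p.1) (innerEnd rH) (𝓝 rH) :=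
      tendsto_fst.mono_right nhdsWithin_le_nhds
    simpa [hn.zero] using hc.mul ((hfst.pow 2).mul (ha.pow 2))

/-- Boundedness at the inner end of `f` and of its derivative along the unit radial vector. This
part of `IsRegularInside` is preserved by linear combinations. -/
structure IsRadiallyBounded (h : MetricFunctions) (rH : ℝ) (f : ℝ → ℝ → ℝ) : Prop where
  bounded : (fun p : ℝ × ℝ => f p.1 p.2) =O[innerEnd rH] fun _ => (1 : ℝ)
  radial : (fun p : ℝ × ℝ => deriv (fun s => f s p.2) p.1 / h.A p.1 p.2)
    =O[innerEnd rH] fun _ => (1 : ℝ)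

theorem IsRegularInside.isRadiallyBounded {h : MetricFunctions} {rH : ℝ} {f : ℝ → ℝ → ℝ}
    (hf : h.IsRegularInside rH f) : h.IsRadiallyBounded rH f where
  bounded := hf.bounded
  radial := by
    have hsq : (fun p : ℝ × ℝ => (deriv (fun s => f s p.2) p.1 / h.A p.1 p.2) ^ 2)
        =O[innerEnd rH] fun _ => (1 : ℝ) := by
      refine (isBigO_of_le _ fun p => ?_).trans hf.gradient
      rw [Real.norm_of_nonneg (sq_nonneg _), Real.norm_of_nonneg (by positivity)]
      exact le_add_of_nonneg_right (sq_nonneg _)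
    exact IsBigO.of_pow two_ne_zero (hsq.congr_right fun _ => (one_pow 2).symm)

theorem eventually_innerEnd (rH : ℝ) : ∀ᶠ p in innerEnd rH, rH < p.1 :=
  tendsto_fst.eventually self_mem_nhdsWithin

namespace IsRadiallyBounded

variable {h : MetricFunctions} {rH : ℝ} {f g : ℝ → ℝ → ℝ}

theorem add (hf : h.IsRadiallyBounded rH f) (hg : h.IsRadiallyBounded rH g)
    (hfr : IsRegularOutside rH f) (hgr : IsRegularOutside rH g) :
    h.IsRadiallyBounded rH fun r θ => f r θ + g r θ where
  bounded := hf.bounded.add hg.bounded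
  radial := by
    refine (hf.radial.add hg.radial).congr' ?_ EventuallyEq.rfl
    filter_upwards [eventually_innerEnd rH] with p hp
    rw [deriv_fun_add
      (differentiableAt_fst (isOpen_outside rH) two_ne_zero hfr.contDiffOn ⟨hp, trivial⟩)
      (differentiableAt_fst (isOpen_outside rH) two_ne_zero hgr.contDiffOn ⟨hp, trivial⟩), add_div]

theorem neg (hf : h.IsRadiallyBounded rH f) : h.IsRadiallyBounded rH fun r θ => -f r θ where
  bounded := hf.bounded.neg_left
  radial := hf.radial.neg_left.congr_left fun p => by rw [deriv.fun_neg, neg_div]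

theorem comp_pi_sub (hf : h.IsRadiallyBounded rH f)
    (hA : ∀ r > rH, ∀ θ, h.A r (Real.pi - θ) = h.A r θ) :
    h.IsRadiallyBounded rH fun r θ => f r (Real.pi - θ) := by
  have hreflect : Tendsto (fun p : ℝ × ℝ => (p.1, Real.pi - p.2)) (innerEnd rH) (innerEnd rH) :=
    tendsto_fst.prodMk tendsto_top
  refine ⟨hf.bounded.comp_tendsto hreflect, (hf.radial.comp_tendsto hreflect).congr' ?_ .rfl⟩
  filter_upwards [eventually_innerEnd rH] with p hp
  simp only [Function.comp_apply, hA p.1 hp]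

theorem tendsto_energyFlux (hf : h.IsRadiallyBounded rH f)
    (hA : ∀ r > rH, ∀ θ, 0 < h.A r θ) (hinner : h.IsBlackHole rH ∨ h.IsNeutronStar rH) :
    Tendsto (h.energyFlux f) (𝓝[>] rH) (𝓝 0) := by
  have hlim : Tendsto (fun p : ℝ × ℝ => h.N p.1 p.2 * (p.1 ^ 2 * h.B p.1 p.2 ^ 2) *
      (deriv (fun s => f s p.2) p.1 / h.A p.1 p.2 * f p.1 p.2)) (innerEnd rH) (𝓝 0) :=
    ((isBigO_refl _ _).mul (hf.radial.mul hf.bounded)).trans_tendsto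
      (by simpa using tendsto_lapse_mul_area hinner)
  refine MetricFunctions.tendsto_energyFlux
    ((hlim.congr' ?_).mono_left (prod_mono_right _ le_top))
  filter_upwards [eventually_innerEnd rH] with p hp
  have hA' := (hA p.1 hp p.2).ne'
  unfold radialFlux radialCoeff
  field_simp

end IsRadiallyBounded

end MetricFunctions

/-! ### Leading terms of expansions in powers of `1/r` -/

/-- Near the direction `θ₀` and for large `r`, the field `f` equals `r ^ k` times a smooth function
of `(1/r, θ)` with value `f₀ θ` at `1/r = 0`. The leading term `f₀` is allowed to vanish. -/
def HasLead (θ₀ : ℝ) (k : ℤ) (f : (Fin 4 → ℝ) → ℝ) (f₀ : ℝ → ℝ) : Prop :=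
  ∃ F : ℝ × ℝ → ℝ, ContDiffAt ℝ (⊤ : ℕ∞) F (0, θ₀) ∧ (∀ᶠ θ in 𝓝 θ₀, F (0, θ) = f₀ θ) ∧
    ∀ᶠ p in atTop ×ˢ 𝓝 θ₀, ∀ t φ, f ![t, p.1, p.2, φ] = p.1 ^ k * F (p.1⁻¹, p.2)

theorem eventually_fst_pos (θ₀ : ℝ) : ∀ᶠ p : ℝ × ℝ in atTop ×ˢ 𝓝 θ₀, 0 < p.1 :=
  tendsto_fst.eventually (eventually_gt_atTop 0)

theorem tendsto_inv_fst (θ₀ : ℝ) :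
    Tendsto (fun p : ℝ × ℝ => (p.1⁻¹, p.2)) (atTop ×ˢ 𝓝 θ₀) (𝓝 (0, θ₀)) :=
  (tendsto_inv_atTop_zero.comp tendsto_fst).prodMk_nhds tendsto_snd

theorem tendsto_zero_prodMk (θ₀ : ℝ) :
    Tendsto (fun θ : ℝ => ((0 : ℝ), θ)) (𝓝 θ₀) (𝓝 (0, θ₀)) :=
  tendsto_const_nhds.prodMk_nhds tendsto_id

theorem eventually_slices {θ₀ : ℝ} {P : ℝ × ℝ → Prop} (h : ∀ᶠ p in atTop ×ˢ 𝓝 θ₀, P p) :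
    ∀ᶠ p : ℝ × ℝ in atTop ×ˢ 𝓝 θ₀, (∀ᶠ s in 𝓝 p.1, P (s, p.2)) ∧ ∀ᶠ τ in 𝓝 p.2, P (p.1, τ) := by
  obtain ⟨pa, ha, pb, hb, hP⟩ := eventually_prod_iff.1 h
  obtain ⟨R, hR⟩ := eventually_atTop.1 ha
  refine eventually_prod_iff.2 ⟨_, eventually_gt_atTop R, _, eventually_eventually_nhds.2 hb, ?_⟩
  intro r hr θ hθ
  refine ⟨?_, hθ.mono fun τ hτ => hP (hR r hr.le) hτ⟩
  filter_upwards [lt_mem_nhds hr] with s hs using hP (hR s hs.le) hθ.self_of_nhds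

theorem contDiffAt_fderiv_apply {F : ℝ × ℝ → ℝ} {q : ℝ × ℝ} (hF : ContDiffAt ℝ (⊤ : ℕ∞) F q)
    (v : ℝ × ℝ) : ContDiffAt ℝ (⊤ : ℕ∞) (fun q => fderiv ℝ F q v) q :=
  (hF.fderiv_right (m := (⊤ : ℕ∞)) (by simp)).clm_apply contDiffAt_const

theorem eventually_hasFDerivAt {F : ℝ × ℝ → ℝ} {q : ℝ × ℝ} (hF : ContDiffAt ℝ (⊤ : ℕ∞) F q) :
    ∀ᶠ q in 𝓝 q, HasFDerivAt F (fderiv ℝ F q) q :=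
  ((hF.of_le (m := 1) (by simp)).eventually (by simp)).mono fun _ h =>
    (h.differentiableAt one_ne_zero).hasFDerivAt

theorem update_zero (t r θ φ s : ℝ) : Function.update ![t, r, θ, φ] 0 s = ![s, r, θ, φ] := by
  ext i; fin_cases i <;> rfl

theorem update_one (t r θ φ s : ℝ) : Function.update ![t, r, θ, φ] 1 s = ![t, s, θ, φ] := by
  ext i; fin_cases i <;> rfl

theorem update_two (t r θ φ s : ℝ) : Function.update ![t, r, θ, φ] 2 s = ![t, r, s, φ] := by
  ext i; fin_cases i <;> rfl

theorem update_three (t r θ φ s : ℝ) : Function.update ![t, r, θ, φ] 3 s = ![t, r, θ, s] := by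
  ext i; fin_cases i <;> rfl

/-- The power of `r` carried by a lower index `μ`. -/
def weight : Fin 4 → ℤ := ![0, 0, 1, 1]

/-- The leading term of `∂_μ f` when `f` has leading term `r ^ k f₀`. -/
def leadDeriv (k : ℤ) (m : Fin 4) (f₀ : ℝ → ℝ) (θ : ℝ) : ℝ := ![0, k * f₀ θ, deriv f₀ θ, 0] m

namespace HasLead

variable {θ₀ : ℝ} {k l : ℤ} {f g : (Fin 4 → ℝ) → ℝ} {f₀ g₀ : ℝ → ℝ}

theorem congr_field (hf : HasLead θ₀ k f f₀)
    (hfg : ∀ᶠ p : ℝ × ℝ in atTop ×ˢ 𝓝 θ₀, ∀ t φ, f ![t, p.1, p.2, φ] = g ![t, p.1, p.2, φ]) :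
    HasLead θ₀ k g f₀ := by
  obtain ⟨F, hF, hF0, hfF⟩ := hf
  refine ⟨F, hF, hF0, ?_⟩
  filter_upwards [hfF, hfg] with p h1 h2 t φ
  rw [← h2, h1]

theorem congr_lead (hf : HasLead θ₀ k f f₀) (hfg : ∀ᶠ θ in 𝓝 θ₀, f₀ θ = g₀ θ) :
    HasLead θ₀ k f g₀ := by
  obtain ⟨F, hF, hF0, hfF⟩ := hf
  exact ⟨F, hF, hF0.mp (hfg.mono fun θ h1 h2 => h2.trans h1), hfF⟩

theorem congr (hf : HasLead θ₀ k f f₀) (hk : k = l := by ring)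
    (hfg : ∀ x, f x = g x := by exact fun _ => rfl)
    (hfg₀ : ∀ θ, f₀ θ = g₀ θ := by exact fun _ => rfl) : HasLead θ₀ l g g₀ := by
  obtain rfl : f = g := funext hfg
  obtain rfl : f₀ = g₀ := funext hfg₀
  exact hk ▸ hf

theorem zero (θ₀ : ℝ) (k : ℤ) : HasLead θ₀ k (fun _ => 0) fun _ => 0 :=
  ⟨fun _ => 0, contDiffAt_const, by simp, by simp⟩

theorem const (θ₀ c : ℝ) : HasLead θ₀ 0 (fun _ => c) fun _ => c :=
  ⟨fun _ => c, contDiffAt_const, by simp, by simp⟩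

theorem radius (θ₀ : ℝ) : HasLead θ₀ 1 (fun x => x 1) fun _ => 1 :=
  ⟨fun _ => 1, contDiffAt_const, by simp, by simp⟩

theorem sin (θ₀ : ℝ) : HasLead θ₀ 0 (fun x => Real.sin (x 2)) Real.sin :=
  ⟨fun q => Real.sin q.2, (Real.contDiff_sin.comp contDiff_snd).contDiffAt, by simp, by simp⟩

theorem add (hf : HasLead θ₀ k f f₀) (hg : HasLead θ₀ k g g₀) :
    HasLead θ₀ k (fun x => f x + g x) fun θ => f₀ θ + g₀ θ := by
  obtain ⟨F, hF, hF0, hfF⟩ := hf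
  obtain ⟨G, hG, hG0, hgG⟩ := hg
  refine ⟨fun q => F q + G q, hF.add hG, ?_, ?_⟩
  · filter_upwards [hF0, hG0] with θ h1 h2
    rw [h1, h2]
  · filter_upwards [hfF, hgG] with p h1 h2 t φ
    rw [h1, h2, mul_add]

theorem mul (hf : HasLead θ₀ k f f₀) (hg : HasLead θ₀ l g g₀) :
    HasLead θ₀ (k + l) (fun x => f x * g x) fun θ => f₀ θ * g₀ θ := by
  obtain ⟨F, hF, hF0, hfF⟩ := hf
  obtain ⟨G, hG, hG0, hgG⟩ := hg
  refine ⟨fun q => F q * G q, hF.mul hG, ?_, ?_⟩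
  · filter_upwards [hF0, hG0] with θ h1 h2
    rw [h1, h2]
  · filter_upwards [hfF, hgG, eventually_fst_pos θ₀] with p h1 h2 hp t φ
    rw [h1, h2, zpow_add₀ hp.ne']
    ring

theorem const_mul (c : ℝ) (hf : HasLead θ₀ k f f₀) :
    HasLead θ₀ k (fun x => c * f x) fun θ => c * f₀ θ :=
  ((const θ₀ c).mul hf).congr

theorem neg (hf : HasLead θ₀ k f f₀) : HasLead θ₀ k (fun x => -f x) fun θ => -f₀ θ :=
  (hf.const_mul (-1)).congr rfl (by simp) (by simp)

theorem sub (hf : HasLead θ₀ k f f₀) (hg : HasLead θ₀ k g g₀) :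
    HasLead θ₀ k (fun x => f x - g x) fun θ => f₀ θ - g₀ θ :=
  (hf.add hg.neg).congr rfl (fun _ => (sub_eq_add_neg _ _).symm) fun _ => (sub_eq_add_neg _ _).symm

theorem sq (hf : HasLead θ₀ k f f₀) :
    HasLead θ₀ (2 * k) (fun x => f x ^ 2) fun θ => f₀ θ ^ 2 :=
  (hf.mul hf).congr (by ring) (fun _ => (pow_two _).symm) fun _ => (pow_two _).symm

theorem sum {ι : Type*} (s : Finset ι) {f : ι → (Fin 4 → ℝ) → ℝ} {f₀ : ι → ℝ → ℝ}
    (hf : ∀ i, HasLead θ₀ k (f i) (f₀ i)) :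
    HasLead θ₀ k (fun x => ∑ i ∈ s, f i x) fun θ => ∑ i ∈ s, f₀ i θ := by
  classical
  induction s using Finset.induction_on with
  | empty => simpa using zero θ₀ k
  | insert i s hi ih => simpa only [Finset.sum_insert hi] using (hf i).add ih

theorem inv (hf : HasLead θ₀ k f f₀) (h0 : f₀ θ₀ ≠ 0) :
    HasLead θ₀ (-k) (fun x => (f x)⁻¹) fun θ => (f₀ θ)⁻¹ := by
  obtain ⟨F, hF, hF0, hfF⟩ := hf
  refine ⟨fun q => (F q)⁻¹, hF.inv (by rwa [hF0.self_of_nhds]), ?_, ?_⟩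
  · filter_upwards [hF0] with θ h1
    rw [h1]
  · filter_upwards [hfF] with p h1 t φ
    rw [h1, mul_inv, zpow_neg]

theorem comp_pi_sub {u : ℝ → ℝ → ℝ} (hu : HasLead (Real.pi - θ₀) k (onChart u) f₀) :
    HasLead θ₀ k (onChart fun r θ => u r (Real.pi - θ)) fun θ => f₀ (Real.pi - θ) := by
  obtain ⟨F, hF, hF0, huF⟩ := hu
  have hsub : Tendsto (fun θ => Real.pi - θ) (𝓝 θ₀) (𝓝 (Real.pi - θ₀)) :=
    (continuous_const.sub continuous_id).tendsto θ₀
  refine ⟨fun q => F (q.1, Real.pi - q.2), ?_, hsub.eventually hF0, ?_⟩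
  · exact ContDiffAt.comp (0, θ₀) (f := fun q : ℝ × ℝ => (q.1, Real.pi - q.2)) hF
      (contDiffAt_fst.prodMk (contDiffAt_const.sub contDiffAt_snd))
  · exact (tendsto_id.prodMap hsub).eventually huF

theorem contDiffAt_lead (hf : HasLead θ₀ k f f₀) : ContDiffAt ℝ (⊤ : ℕ∞) f₀ θ₀ := by
  obtain ⟨F, hF, hF0, -⟩ := hf
  have hslice : ContDiffAt ℝ (⊤ : ℕ∞) (fun θ => F (0, θ)) θ₀ :=
    hF.comp θ₀ (contDiffAt_const.prodMk contDiffAt_id)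
  exact hslice.congr_of_eventuallyEq (hF0.mono fun _ h => h.symm)

theorem tendsto_prod (hf : HasLead θ₀ k f f₀) (t φ : ℝ) :
    Tendsto (fun p : ℝ × ℝ => p.1 ^ (-k) * f ![t, p.1, p.2, φ]) (atTop ×ˢ 𝓝 θ₀)
      (𝓝 (f₀ θ₀)) := by
  obtain ⟨F, hF, hF0, hfF⟩ := hf
  rw [← hF0.self_of_nhds]
  refine (hF.continuousAt.tendsto.comp (tendsto_inv_fst θ₀)).congr' ?_
  filter_upwards [hfF, eventually_fst_pos θ₀] with p hp hr
  rw [hp, ← mul_assoc, ← zpow_add₀ hr.ne', neg_add_cancel, zpow_zero, one_mul, Function.comp_apply]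

theorem tendsto (hf : HasLead θ₀ k f f₀) (t φ : ℝ) :
    Tendsto (fun r => r ^ (-k) * f ![t, r, θ₀, φ]) atTop (𝓝 (f₀ θ₀)) :=
  (hf.tendsto_prod t φ).comp (f := fun r => (r, θ₀)) (tendsto_id.prodMk tendsto_const_nhds)

theorem eventually_ne (hf : HasLead θ₀ k f f₀) (h0 : f₀ θ₀ ≠ 0) :
    ∀ᶠ p : ℝ × ℝ in atTop ×ˢ 𝓝 θ₀, ∀ t φ, f ![t, p.1, p.2, φ] ≠ 0 := by
  obtain ⟨F, hF, hF0, hfF⟩ := hf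
  have hF_ne : ∀ᶠ q in 𝓝 ((0 : ℝ), θ₀), F q ≠ 0 :=
    hF.continuousAt.eventually_ne (by rwa [hF0.self_of_nhds])
  filter_upwards [hfF, eventually_fst_pos θ₀, (tendsto_inv_fst θ₀).eventually hF_ne]
    with p hp hr hne t φ
  rw [hp]
  exact mul_ne_zero (zpow_ne_zero _ hr.ne') hne

theorem of_order_lt {l : ℤ} (hkl : k < l) (hf : HasLead θ₀ k f f₀) :
    HasLead θ₀ l f fun _ => 0 := by
  obtain ⟨F, hF, -, hfF⟩ := hf
  obtain ⟨n, hn⟩ := Int.eq_ofNat_of_zero_le (sub_nonneg.2 hkl.le)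
  refine ⟨fun q => q.1 ^ n * F q, (contDiffAt_fst.pow n).mul hF, .of_forall fun θ => ?_, ?_⟩
  · simp [show n ≠ 0 by omega]
  · filter_upwards [hfF, eventually_fst_pos θ₀] with p hp hr t φ
    rw [hp, show k = l - n by omega, zpow_sub₀ hr.ne', zpow_natCast, inv_pow]
    ring

theorem exists_order_sub_one (hf : HasLead θ₀ k f f₀) (h0 : ∀ᶠ θ in 𝓝 θ₀, f₀ θ = 0) :
    ∃ f₁, HasLead θ₀ (k - 1) f f₁ := by
  obtain ⟨F, hF, hF0, hfF⟩ := hf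
  obtain ⟨G, hG, hFG⟩ := exists_contDiffAt_smul_eq_sub hF
  refine ⟨fun θ => G (0, θ), G, hG, .of_forall fun _ => rfl, ?_⟩
  filter_upwards [hfF, (tendsto_inv_fst θ₀).eventually hFG, eventually_fst_pos θ₀,
    tendsto_snd.eventually hF0, tendsto_snd.eventually h0] with p hp hG hr hF0 h0 t φ
  have hFG : F (p.1⁻¹, p.2) = p.1⁻¹ * G (p.1⁻¹, p.2) := by
    rw [← smul_eq_mul, ← hG, hF0, h0, sub_zero]
  rw [hp, hFG, zpow_sub_one₀ hr.ne', mul_assoc]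

theorem eventually_tendsto (hf : HasLead θ₀ k f f₀) (t φ : ℝ) :
    ∀ᶠ θ in 𝓝 θ₀, Tendsto (fun r => r ^ (-k) * f ![t, r, θ, φ]) atTop (𝓝 (f₀ θ)) := by
  obtain ⟨F, hF, hF0, hfF⟩ := hf
  have hF_smooth : ∀ᶠ q in 𝓝 ((0 : ℝ), θ₀), ContinuousAt F q :=
    ((hF.of_le (m := 1) (by simp)).eventually (by simp)).mono fun _ h => h.continuousAt
  obtain ⟨_, hlarge, _, hnear, hfF⟩ := eventually_prod_iff.1 hfF
  filter_upwards [hF0, (tendsto_zero_prodMk θ₀).eventually hF_smooth, hnear] with θ h0 hcont hθ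
  rw [← h0]
  have hinv : Tendsto (fun r : ℝ => (r⁻¹, θ)) atTop (𝓝 (0, θ)) :=
    tendsto_inv_atTop_zero.prodMk_nhds tendsto_const_nhds
  refine (hcont.tendsto.comp hinv).congr' ?_
  filter_upwards [hlarge, eventually_gt_atTop 0] with r hr hr0
  rw [hfF hr hθ t φ, ← mul_assoc, ← zpow_add₀ hr0.ne', neg_add_cancel, zpow_zero, one_mul,
    Function.comp_apply]

theorem of_tendsto (hlk : l ≤ k) (hf : HasLead θ₀ k f f₀)
    (hlim : ∀ θ, Tendsto (fun r => r ^ (-l) * f ![0, r, θ, 0]) atTop (𝓝 (g₀ θ))) :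
    HasLead θ₀ l f g₀ := by
  obtain ⟨n, rfl⟩ := Int.le.dest hlk
  clear hlk
  induction n generalizing f₀ with
  | zero =>
    refine (hf.congr (by simp)).congr_lead ?_
    filter_upwards [hf.eventually_tendsto 0 0] with θ hθ
    exact tendsto_nhds_unique (by simpa using hθ) (hlim θ)
  | succ n ih =>
    have hlead : ∀ᶠ θ in 𝓝 θ₀, f₀ θ = 0 := by
      filter_upwards [hf.eventually_tendsto 0 0] with θ hθ
      have hzero : Tendsto (fun r : ℝ => (r ^ (n + 1))⁻¹ * (r ^ (-l) * f ![0, r, θ, 0])) atTop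
          (𝓝 0) := by
        simpa using (tendsto_pow_atTop n.succ_ne_zero).inv_tendsto_atTop.mul (hlim θ)
      refine tendsto_nhds_unique (hθ.congr' ?_) hzero
      filter_upwards [eventually_gt_atTop 0] with r hr
      rw [← mul_assoc, ← zpow_natCast, ← zpow_neg, ← zpow_add₀ hr.ne']
      congr 2
      ring
    obtain ⟨f₁, hf₁⟩ := hf.exists_order_sub_one hlead
    exact ih (hf₁.congr (by push_cast; ring))

theorem lead_unique (hf : HasLead θ₀ k f f₀) (hg : HasLead θ₀ k f g₀) : f₀ θ₀ = g₀ θ₀ :=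
  tendsto_nhds_unique (hf.tendsto 0 0) (hg.tendsto 0 0)

theorem of_sub_one {a : ℝ → ℝ} (hf : HasLead θ₀ (-1) (fun x => f x - 1) a) :
    HasLead θ₀ 0 f fun _ => 1 :=
  ((hf.of_order_lt (by norm_num)).add (const θ₀ 1)).congr rfl (fun _ => sub_add_cancel _ _)
    fun _ => zero_add _

theorem mul_sub_one {a b : ℝ → ℝ} (hf : HasLead θ₀ (-1) (fun x => f x - 1) a)
    (hg : HasLead θ₀ (-1) (fun x => g x - 1) b) :
    HasLead θ₀ (-1) (fun x => f x * g x - 1) fun θ => a θ + b θ :=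
  ((hf.add hg).add ((hf.mul hg).of_order_lt (by norm_num))).congr rfl (fun _ => by ring)
    fun _ => add_zero _

theorem inv_sub_one {a : ℝ → ℝ} (hf : HasLead θ₀ (-1) (fun x => f x - 1) a) :
    HasLead θ₀ (-1) (fun x => (f x)⁻¹ - 1) fun θ => -a θ := by
  have hf1 := hf.of_sub_one
  refine ((hf.mul (hf1.inv one_ne_zero)).neg.congr (by ring) (fun _ => rfl)
    (fun θ => by rw [inv_one, mul_one])).congr_field ?_
  filter_upwards [hf1.eventually_ne one_ne_zero] with p hp t φ
  have := hp t φ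
  field_simp
  ring

theorem pd_zero (l : ℤ) (hf : HasLead θ₀ k f f₀) : HasLead θ₀ l (SGB.pd 0 f) fun _ => 0 := by
  obtain ⟨F, -, -, hfF⟩ := hf
  refine (zero θ₀ l).congr_field ?_
  filter_upwards [hfF] with p hp t φ
  simp [SGB.pd, update_zero, hp]

theorem pd_three (l : ℤ) (hf : HasLead θ₀ k f f₀) : HasLead θ₀ l (SGB.pd 3 f) fun _ => 0 := by
  obtain ⟨F, -, -, hfF⟩ := hf
  refine (zero θ₀ l).congr_field ?_
  filter_upwards [hfF] with p hp t φ
  simp [SGB.pd, update_three, hp]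

theorem pd_one (hf : HasLead θ₀ k f f₀) :
    HasLead θ₀ (k - 1) (SGB.pd 1 f) fun θ => k * f₀ θ := by
  obtain ⟨F, hF, hF0, hfF⟩ := hf
  refine ⟨fun q => k * F q - q.1 * fderiv ℝ F q (1, 0), (contDiffAt_const.mul hF).sub
    (contDiffAt_fst.mul (contDiffAt_fderiv_apply hF _)), hF0.mono fun θ hθ => by simp [hθ], ?_⟩
  filter_upwards [eventually_slices hfF, eventually_fst_pos θ₀,
    (tendsto_inv_fst θ₀).eventually (eventually_hasFDerivAt hF)] with p hp hr hd t φ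
  have hF' : HasDerivAt (fun s : ℝ => F (s⁻¹, p.2))
      (-(p.1 ^ 2)⁻¹ * fderiv ℝ F (p.1⁻¹, p.2) (1, 0)) p.1 := by
    have hcomp := hd.comp_hasDerivAt p.1
      ((hasDerivAt_inv hr.ne').prodMk (hasDerivAt_const p.1 p.2))
    have hsmul : fderiv ℝ F (p.1⁻¹, p.2) (-(p.1 ^ 2)⁻¹, 0) =
        -(p.1 ^ 2)⁻¹ * fderiv ℝ F (p.1⁻¹, p.2) (1, 0) := by
      rw [← smul_eq_mul, ← map_smul]; simp
    exact hsmul ▸ hcomp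
  have hf_eq : (fun s => f ![t, s, p.2, φ]) =ᶠ[𝓝 p.1] fun s => s ^ k * F (s⁻¹, p.2) :=
    hp.1.mono fun s hs => hs t φ
  have hderiv := (((hasDerivAt_zpow k p.1 (.inl hr.ne')).fun_mul hF').congr_of_eventuallyEq
    hf_eq).deriv
  simp only [SGB.pd, update_one, Matrix.cons_val_one, Matrix.cons_val_zero]
  rw [hderiv, zpow_sub_one₀ hr.ne']
  field_simp
  ring

theorem pd_two (hf : HasLead θ₀ k f f₀) : HasLead θ₀ k (SGB.pd 2 f) (deriv f₀) := by
  obtain ⟨F, hF, hF0, hfF⟩ := hf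
  have hslice {q : ℝ × ℝ} (hq : HasFDerivAt F (fderiv ℝ F q) q) :
      HasDerivAt (fun τ => F (q.1, τ)) (fderiv ℝ F q (0, 1)) q.2 :=
    hq.comp_hasDerivAt q.2 ((hasDerivAt_const q.2 q.1).prodMk (hasDerivAt_id q.2))
  have hd := eventually_hasFDerivAt hF
  refine ⟨fun q => fderiv ℝ F q (0, 1), contDiffAt_fderiv_apply hF _, ?_, ?_⟩
  · filter_upwards [eventually_eventually_nhds.2 hF0, (tendsto_zero_prodMk θ₀).eventually hd]
      with θ hθ hd
    exact ((hslice hd).congr_of_eventuallyEq (hθ.mono fun τ hτ => hτ.symm)).deriv.symm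
  · filter_upwards [eventually_slices hfF, (tendsto_inv_fst θ₀).eventually hd] with p hp hd t φ
    have hf_eq : (fun s => f ![t, p.1, s, φ]) =ᶠ[𝓝 p.2] fun s => p.1 ^ k * F (p.1⁻¹, s) :=
      hp.2.mono fun s hs => hs t φ
    simp only [SGB.pd, update_two, Matrix.cons_val]
    exact (((hslice hd).const_mul (p.1 ^ k)).congr_of_eventuallyEq hf_eq).deriv

theorem pd (hf : HasLead θ₀ k f f₀) (m : Fin 4) :
    HasLead θ₀ (k + weight m - 1) (SGB.pd m f) (leadDeriv k m f₀) := by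
  fin_cases m
  · exact hf.pd_zero _
  · exact hf.pd_one.congr (by simp [weight])
  · exact hf.pd_two.congr (by simp [weight])
  · exact hf.pd_three _

end HasLead

theorem SmoothAtInfinity.exists_hasLead {f : ℝ → ℝ → ℝ} (hf : SmoothAtInfinity f) (θ₀ : ℝ) :
    ∃ f₀, HasLead θ₀ 0 (onChart f) f₀ := by
  obtain ⟨δ, hδ, F, hF, hfF⟩ := hf
  refine ⟨fun θ => F (0, θ), F, hF.contDiffAt ((isOpen_Ioo.prod isOpen_univ).mem_nhds
    ⟨by simpa using hδ, mem_univ _⟩), .of_forall fun _ => rfl, ?_⟩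
  filter_upwards [tendsto_fst.eventually (eventually_gt_atTop δ⁻¹)] with p hp t φ
  simpa [onChart] using hfF p.1 hp p.2

theorem IsBigOInv.tendsto_pow_mul {n m : ℕ} (hmn : m < n) {f : ℝ → ℝ → ℝ} (hf : IsBigOInv n f)
    (θ : ℝ) : Tendsto (fun r => r ^ m * f r θ) atTop (𝓝 0) := by
  have hslice : (fun r => f r θ) =O[atTop] fun r : ℝ => (r ^ n)⁻¹ :=
    hf.comp_tendsto (k := fun r => (r, θ)) (tendsto_id.prodMk tendsto_top)
  refine ((isBigO_refl (fun r : ℝ => r ^ m) atTop).mul hslice).trans_tendsto ?_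
  refine (tendsto_pow_atTop (Nat.sub_ne_zero_of_lt hmn)).inv_tendsto_atTop.congr' ?_
  filter_upwards [eventually_gt_atTop 0] with r hr
  rw [Pi.inv_apply, pow_sub₀ r hr.ne' hmn.le, mul_inv, inv_inv, mul_comm]

/-! ### The wave operator on expansions in powers of `1/r` -/

theorem SmoothAtInfinity.hasLead_sub_one {f : ℝ → ℝ → ℝ} (hf : SmoothAtInfinity f) {c : ℝ}
    (hc : IsBigOInv 2 fun r θ => f r θ - (1 + c / r)) (θ₀ : ℝ) :
    HasLead θ₀ (-1) (fun x => onChart f x - 1) fun _ => c := by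
  obtain ⟨f₀, hf₀⟩ := hf.exists_hasLead θ₀
  refine (hf₀.sub (HasLead.const θ₀ 1)).of_tendsto (by norm_num) fun θ => ?_
  have hlim := (hc.tendsto_pow_mul one_lt_two θ).add_const c
  rw [zero_add] at hlim
  refine hlim.congr' ?_
  filter_upwards [eventually_ne_atTop 0] with r hr
  change r ^ 1 * (f r θ - (1 + c / r)) + c = r ^ (1 : ℤ) * (f r θ - 1)
  rw [pow_one, zpow_one]
  field_simp
  ring

namespace MetricFunctions

section

variable {h : MetricFunctions} {rH : ℝ} {f g : ℝ → ℝ → ℝ}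

theorem IsSpacetime.waveOp_add (hs : h.IsSpacetime rH)
    (hf : IsRegularOutside rH f) (hg : IsRegularOutside rH g) {r : ℝ} (hr : rH < r) (θ : ℝ) :
    h.waveOp (fun r θ => f r θ + g r θ) r θ = h.waveOp f r θ + h.waveOp g r θ := by
  have hU := isOpen_outside rH
  have hradial : (fun s => h.radialFlux (fun r θ => f r θ + g r θ) s θ) =ᶠ[𝓝 r]
      fun s => h.radialFlux f s θ + h.radialFlux g s θ := by
    filter_upwards [lt_mem_nhds hr] with s hs
    simp only [radialFlux]
    rw [deriv_fun_add (differentiableAt_fst hU two_ne_zero hf.contDiffOn ⟨hs, trivial⟩)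
      (differentiableAt_fst hU two_ne_zero hg.contDiffOn ⟨hs, trivial⟩), mul_add]
  have hangular : h.angularFlux (fun r θ => f r θ + g r θ) r =
      fun τ => h.angularFlux f r τ + h.angularFlux g r τ := by
    funext τ
    simp only [angularFlux]
    rw [deriv_fun_add (differentiableAt_snd hU two_ne_zero hf.contDiffOn ⟨hr, trivial⟩)
      (differentiableAt_snd hU two_ne_zero hg.contDiffOn ⟨hr, trivial⟩), mul_add]
  unfold waveOp
  rw [hradial.deriv_eq, hangular,
    deriv_fun_add
      (differentiableAt_fst hU one_ne_zero (hs.contDiffOn_radialFlux hf) ⟨hr, trivial⟩)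
      (differentiableAt_fst hU one_ne_zero (hs.contDiffOn_radialFlux hg) ⟨hr, trivial⟩),
    deriv_fun_add
      (differentiableAt_snd hU one_ne_zero (hs.contDiffOn_angularFlux hf) ⟨hr, trivial⟩)
      (differentiableAt_snd hU one_ne_zero (hs.contDiffOn_angularFlux hg) ⟨hr, trivial⟩)]
  ring

theorem waveOp_neg (h : MetricFunctions) (f : ℝ → ℝ → ℝ) (r θ : ℝ) :
    h.waveOp (fun r θ => -f r θ) r θ = -h.waveOp f r θ := by
  have hangular : h.angularFlux (fun r θ => -f r θ) r = fun τ => -h.angularFlux f r τ := by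
    funext τ
    simp only [angularFlux, deriv.fun_neg, mul_neg]
  simp only [waveOp, hangular, radialFlux, deriv.fun_neg, mul_neg]
  ring

theorem waveOp_comp_pi_sub (hN : ∀ r > rH, ∀ θ, h.N r (Real.pi - θ) = h.N r θ)
    (hA : ∀ r > rH, ∀ θ, h.A r (Real.pi - θ) = h.A r θ)
    (hB : ∀ r > rH, ∀ θ, h.B r (Real.pi - θ) = h.B r θ) {r : ℝ} (hr : rH < r) (θ : ℝ) :
    h.waveOp (fun r θ => f r (Real.pi - θ)) r θ = h.waveOp f r (Real.pi - θ) := by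
  have hradial : (fun s => h.radialFlux (fun r θ => f r (Real.pi - θ)) s θ) =ᶠ[𝓝 r]
      fun s => h.radialFlux f s (Real.pi - θ) := by
    filter_upwards [lt_mem_nhds hr] with s hs
    simp only [radialFlux, radialCoeff, hN s hs, hA s hs, hB s hs]
  have hangular : h.angularFlux (fun r θ => f r (Real.pi - θ)) r =
      fun τ => -h.angularFlux f r (Real.pi - τ) := by
    funext τ
    simp only [angularFlux, angularCoeff, hN r hr, hA r hr, Real.sin_pi_sub,
      deriv_comp_const_sub (f := f r), mul_neg]
  simp only [waveOp, hradial.deriv_eq, hangular, deriv.fun_neg, Real.sin_pi_sub,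
    deriv_comp_const_sub (f := h.angularFlux f r), neg_neg]

theorem IsReflectionSymmetric.eq_pi_sub (h0 : 0 ≤ rH) (hs : h.IsSpacetime rH)
    (hrefl : h.IsReflectionSymmetric rH) {r : ℝ} (hr : rH < r) (θ : ℝ) :
    h.N r (Real.pi - θ) = h.N r θ ∧ h.A r (Real.pi - θ) = h.A r θ ∧
      h.B r (Real.pi - θ) = h.B r θ := by
  have heq {τ} (hτ : τ ∈ Ioo 0 Real.pi) := hrefl.eq_of_mem_Ioo h0 hs hr hτ
  exact ⟨congrFun (hs.regN.comp_pi_sub.eq_of_eqOn_Ioo hs.regN hr fun τ hτ => (heq hτ).1) θ,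
    congrFun (hs.regA.comp_pi_sub.eq_of_eqOn_Ioo hs.regA hr fun τ hτ => (heq hτ).2.1) θ,
    congrFun (hs.regB.comp_pi_sub.eq_of_eqOn_Ioo hs.regB hr fun τ hτ => (heq hτ).2.2.1) θ⟩

end

namespace IsAMC

variable {h : MetricFunctions} {M J : ℝ} (hA : h.IsAMC M J) (θ₀ : ℝ)
include hA

theorem hasLead_N_sub_one : HasLead θ₀ (-1) (fun x => onChart h.N x - 1) fun _ => -M :=
  hA.smoothN.hasLead_sub_one (by simpa [neg_div, sub_eq_add_neg] using hA.expandN) θ₀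

theorem hasLead_A_sub_one : HasLead θ₀ (-1) (fun x => onChart h.A x - 1) fun _ => M :=
  hA.smoothA.hasLead_sub_one hA.expandA θ₀

theorem hasLead_B_sub_one : HasLead θ₀ (-1) (fun x => onChart h.B x - 1) fun _ => 0 :=
  hA.smoothB.hasLead_sub_one (by simpa using hA.expandB) θ₀

theorem hasLead_N : HasLead θ₀ 0 (onChart h.N) fun _ => 1 := (hA.hasLead_N_sub_one θ₀).of_sub_one

theorem hasLead_A : HasLead θ₀ 0 (onChart h.A) fun _ => 1 := (hA.hasLead_A_sub_one θ₀).of_sub_one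

theorem hasLead_B : HasLead θ₀ 0 (onChart h.B) fun _ => 1 := (hA.hasLead_B_sub_one θ₀).of_sub_one

theorem hasLead_ω : HasLead θ₀ (-3) (onChart h.ω) fun _ => 2 * J := by
  obtain ⟨ω₀, hω₀⟩ := hA.smoothω.exists_hasLead θ₀
  refine hω₀.of_tendsto (by norm_num) fun θ => ?_
  have hlim := (hA.expandω.tendsto_pow_mul (by norm_num : 3 < 4) θ).add_const (2 * J)
  rw [zero_add] at hlim
  refine hlim.congr' ?_
  filter_upwards [eventually_ne_atTop 0] with r hr
  change r ^ 3 * (h.ω r θ - 2 * J / r ^ 3) + 2 * J = r ^ (3 : ℤ) * h.ω r θ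
  rw [mul_sub, mul_div_cancel₀ _ (pow_ne_zero 3 hr), sub_add_cancel]
  norm_cast

variable {θ₀}

theorem hasLead_radialFlux {k : ℤ} {f : ℝ → ℝ → ℝ} {f₀ : ℝ → ℝ}
    (hf : HasLead θ₀ k (onChart f) f₀) :
    HasLead θ₀ (k + 1) (onChart (h.radialFlux f)) fun θ => k * f₀ θ := by
  have hcoeff : HasLead θ₀ 2 (onChart h.radialCoeff) fun _ => 1 :=
    (((hA.hasLead_N θ₀).mul ((HasLead.radius θ₀).sq.mul (hA.hasLead_B θ₀).sq)).mul
      ((hA.hasLead_A θ₀).inv one_ne_zero)).congr (by norm_num)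
      (fun _ => (div_eq_mul_inv _ _).symm) fun _ => by norm_num
  exact (hcoeff.mul hf.pd_one).congr (by ring)
    (fun x => by rw [pd_one_onChart]; rfl) fun _ => one_mul _

theorem hasLead_angularFlux {k : ℤ} {f : ℝ → ℝ → ℝ} {f₀ : ℝ → ℝ}
    (hf : HasLead θ₀ k (onChart f) f₀) :
    HasLead θ₀ k (onChart (h.angularFlux f)) fun θ => Real.sin θ * deriv f₀ θ :=
  ((((hA.hasLead_N θ₀).mul (hA.hasLead_A θ₀)).mul (HasLead.sin θ₀)).mul hf.pd_two).congr (by ring)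
    (fun x => by rw [pd_two_onChart]; rfl) fun _ => by ring

theorem hasLead_waveOp {k : ℤ} {f : ℝ → ℝ → ℝ} {f₀ : ℝ → ℝ}
    (hf : HasLead θ₀ k (onChart f) f₀) :
    HasLead θ₀ k (onChart (h.waveOp f)) fun θ =>
      (k + 1) * k * f₀ θ * Real.sin θ + deriv (fun τ => Real.sin τ * deriv f₀ τ) θ :=
  (((hA.hasLead_radialFlux hf).pd_one.mul (HasLead.sin θ₀)).congr.add
    (hA.hasLead_angularFlux hf).pd_two).congr rfl
    (fun x => by rw [pd_one_onChart, pd_two_onChart]; rfl) fun θ => by push_cast; ring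

theorem hasLead_waveOp_monopole (θ₀ m : ℝ) :
    HasLead θ₀ (-2) (onChart (h.waveOp fun r _ => m / r)) fun θ => -2 * M * m * Real.sin θ := by
  -- The flux of `m/r` is `-m κ` with `κ = N B² / A`, so only `κ - 1 = -2M/r + O(r⁻²)` contributes.
  have hκ : HasLead θ₀ (-1) (fun x => onChart h.N x * (onChart h.B x * onChart h.B x) *
      (onChart h.A x)⁻¹ - 1) fun _ => -2 * M :=
    (((hA.hasLead_N_sub_one θ₀).mul_sub_one ((hA.hasLead_B_sub_one θ₀).mul_sub_one
      (hA.hasLead_B_sub_one θ₀))).mul_sub_one (hA.hasLead_A_sub_one θ₀).inv_sub_one).congr rfl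
      (fun _ => rfl) fun _ => by ring
  have hflux : HasLead θ₀ (-1) (onChart fun r θ => h.radialFlux (fun r _ => m / r) r θ + m)
      fun _ => 2 * M * m := by
    refine (hκ.const_mul (-m)).congr_lead (.of_forall fun _ => by ring) |>.congr_field ?_
    filter_upwards [eventually_fst_pos θ₀] with p hp t φ
    have hderiv : deriv (fun s => m / s) p.1 = -m / p.1 ^ 2 := by simp [div_eq_mul_inv]
    simp only [onChart, radialFlux, radialCoeff, Matrix.cons_val, hderiv]
    field_simp
    ring
  refine (hflux.pd_one.mul (HasLead.sin θ₀)).congr (by norm_num) (fun x => ?_) fun θ => ?_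
  · have hangular : h.angularFlux (fun r _ => m / r) (x 1) = fun _ => 0 := by
      funext θ
      simp [angularFlux]
    rw [pd_one_onChart, deriv_add_const]
    simp [onChart, waveOp, hangular]
  · push_cast
    ring

end IsAMC

theorem eq_zero_of_hasLead {h : MetricFunctions} {rH M J : ℝ} {χ : ℝ → ℝ → ℝ}
    (hs : h.IsSpacetime rH) (hA : h.IsAMC M J) (hinner : h.IsBlackHole rH ∨ h.IsNeutronStar rH)
    (hχ : IsRegularOutside rH χ) (hbdd : h.IsRadiallyBounded rH χ)
    (heq : ∀ r > rH, ∀ θ ∈ Ioo 0 Real.pi, h.waveOp χ r θ = 0)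
    (hlead : ∀ θ₀, HasLead θ₀ 0 (onChart χ) fun _ => 0) :
    ∀ r > rH, ∀ θ, χ r θ = 0 := by
  refine hs.eq_zero_of_tendsto_energyFlux (inner_nonneg hinner) hχ heq
    (hbdd.tendsto_energyFlux hs.posA hinner) (tendsto_energyFlux ?_)
    fun θ _ => by simpa [onChart] using (hlead θ).tendsto 0 0
  refine Tendsto.mono_left ?_ (prod_mono_right _ principal_le_nhdsSet)
  rw [isCompact_Icc.prod_nhdsSet_eq_biSup, tendsto_iSup]
  refine fun θ₀ => tendsto_iSup.2 fun _ => ?_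
  obtain ⟨χ₁, hχ₁⟩ := (hlead θ₀).exists_order_sub_one (.of_forall fun _ => rfl)
  have hflux := ((hA.hasLead_radialFlux hχ₁).mul hχ₁).of_order_lt (l := 0) (by norm_num)
  simpa [onChart] using hflux.tendsto_prod 0 0

end MetricFunctions

/-! ### Decay of the Gauss–Bonnet invariant -/

/-- The coefficients `g₀` in the components `r ^ (weight a + weight b) * g₀ a b θ` of the Minkowski
metric in spherical coordinates `(t, r, θ, φ)`. -/
def flatMetric (a b : Fin 4) (θ : ℝ) : ℝ :=
  if a = b then ![-1, 1, 1, Real.sin θ ^ 2] a else 0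

/-- The coefficients of the inverse Minkowski metric, normalised as in `flatMetric`. -/
def flatMetricInv (a b : Fin 4) (θ : ℝ) : ℝ :=
  if a = b then ![-1, 1, 1, (Real.sin θ ^ 2)⁻¹] a else 0

/-- The coefficients `c` in the Christoffel symbols
`Γ^l_{mn} = r ^ (weight m + weight n - weight l - 1) * c l m n θ` of the Minkowski metric. -/
def flatChristoffel (l m n : Fin 4) (θ : ℝ) : ℝ :=
  (![fun _ _ => 0,
    ![![0, 0, 0, 0], ![0, 0, 0, 0], ![0, 0, -1, 0], ![0, 0, 0, -Real.sin θ ^ 2]],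
    ![![0, 0, 0, 0], ![0, 0, 1, 0], ![0, 1, 0, 0], ![0, 0, 0, -(Real.sin θ * Real.cos θ)]],
    ![![0, 0, 0, 0], ![0, 0, 0, 1], ![0, 0, 0, Real.cos θ / Real.sin θ],
      ![0, 1, Real.cos θ / Real.sin θ, 0]]] : Fin 4 → Fin 4 → Fin 4 → ℝ) l m n

/-- The derivatives in `θ` of the coefficients `flatChristoffel`, away from the axis. -/
def flatChristoffelDeriv (l m n : Fin 4) (θ : ℝ) : ℝ :=
  (![fun _ _ => 0,
    ![![0, 0, 0, 0], ![0, 0, 0, 0], ![0, 0, 0, 0], ![0, 0, 0, -2 * Real.sin θ * Real.cos θ]],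
    ![![0, 0, 0, 0], ![0, 0, 0, 0], ![0, 0, 0, 0],
      ![0, 0, 0, Real.sin θ ^ 2 - Real.cos θ ^ 2]],
    ![![0, 0, 0, 0], ![0, 0, 0, 0], ![0, 0, 0, -(Real.sin θ ^ 2)⁻¹],
      ![0, 0, -(Real.sin θ ^ 2)⁻¹, 0]]] : Fin 4 → Fin 4 → Fin 4 → ℝ) l m n

theorem deriv_flatMetric (a b : Fin 4) (θ : ℝ) : deriv (flatMetric a b) θ =
    if a = 3 ∧ b = 3 then 2 * Real.sin θ * Real.cos θ else 0 := by
  unfold flatMetric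
  fin_cases a <;> fin_cases b <;> simp

theorem deriv_flatChristoffel {θ : ℝ} (hsin : Real.sin θ ≠ 0) (l m n : Fin 4) :
    deriv (flatChristoffel l m n) θ = flatChristoffelDeriv l m n θ := by
  have hconst (c : ℝ) : HasDerivAt (fun _ => c) 0 θ := hasDerivAt_const θ c
  have hsq : HasDerivAt (fun θ => -Real.sin θ ^ 2) (-2 * Real.sin θ * Real.cos θ) θ :=
    ((Real.hasDerivAt_sin θ).pow 2).neg.congr_deriv (by simp)
  have hmul : HasDerivAt (fun θ => -(Real.sin θ * Real.cos θ))
      (Real.sin θ ^ 2 - Real.cos θ ^ 2) θ :=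
    ((Real.hasDerivAt_sin θ).mul (Real.hasDerivAt_cos θ)).neg.congr_deriv (by ring)
  have hcot : HasDerivAt (fun θ => Real.cos θ / Real.sin θ) (-(Real.sin θ ^ 2)⁻¹) θ := by
    refine ((Real.hasDerivAt_cos θ).div (Real.hasDerivAt_sin θ) hsin).congr_deriv ?_
    field_simp
    linarith [Real.sin_sq_add_cos_sq θ]
  fin_cases l <;> fin_cases m <;> fin_cases n <;>
    first
    | exact (hconst _).deriv
    | exact hsq.deriv
    | exact hmul.deriv
    | exact hcot.deriv

theorem flatChristoffel_eq {θ : ℝ} (hsin : Real.sin θ ≠ 0) (l m n : Fin 4) :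
    1 / 2 * ∑ s, flatMetricInv l s θ *
      (leadDeriv (weight s + weight n) m (flatMetric s n) θ +
        leadDeriv (weight s + weight m) n (flatMetric s m) θ -
        leadDeriv (weight m + weight n) s (flatMetric m n) θ) = flatChristoffel l m n θ := by
  have hdiag (c : Fin 4 → ℝ) : ∑ s, flatMetricInv l s θ * c s = flatMetricInv l l θ * c l :=
    Finset.sum_eq_single l (fun s _ hs => by simp [flatMetricInv, hs.symm]) (by simp)
  rw [hdiag fun s => _]
  simp only [leadDeriv, deriv_flatMetric]
  fin_cases l <;> fin_cases m <;> fin_cases n <;>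
    simp [flatMetric, flatMetricInv, weight, flatChristoffel] <;> field_simp

theorem flatRiemann_eq_zero {θ : ℝ} (hsin : Real.sin θ ≠ 0) (a b m n : Fin 4) :
    leadDeriv (weight n + weight b - weight a - 1) m (flatChristoffel a n b) θ -
      leadDeriv (weight m + weight b - weight a - 1) n (flatChristoffel a m b) θ +
      ∑ l, (flatChristoffel a m l θ * flatChristoffel l n b θ -
        flatChristoffel a n l θ * flatChristoffel l m b θ) = 0 := by
  have hpyth := Real.sin_sq_add_cos_sq θ
  simp only [leadDeriv, deriv_flatChristoffel hsin, Fin.sum_univ_four]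
  fin_cases a <;> fin_cases b <;> fin_cases m <;> fin_cases n <;>
    simp only [Fin.reduceFinMk, Fin.zero_eta, Fin.mk_one, weight, flatChristoffel,
      flatChristoffelDeriv, Matrix.cons_val, mul_zero, zero_mul, add_zero, sub_self] <;>
    first | ring1 | (field_simp; linarith)

namespace HasLead

variable {g : MetricField} {θ₀ : ℝ}
  (hg : ∀ a b, HasLead θ₀ (weight a + weight b) (fun x => g x a b) (flatMetric a b))
  (hgi : ∀ a b, HasLead θ₀ (-(weight a + weight b)) (fun x => (g x)⁻¹ a b) (flatMetricInv a b))
  (hθ : Real.sin θ₀ ≠ 0)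
include hg hgi hθ

theorem christoffel (l m n : Fin 4) :
    HasLead θ₀ (weight m + weight n - weight l - 1) (christoffel g l m n)
      (flatChristoffel l m n) := by
  have hterm (s : Fin 4) : HasLead θ₀ (weight m + weight n - weight l - 1) _ _ :=
    ((hgi l s).mul ((((hg s n).pd m).congr (l := weight s + weight n + weight m - 1)).add
      ((hg s m).pd n).congr |>.sub ((hg m n).pd s).congr)).congr
  exact ((HasLead.sum Finset.univ hterm).const_mul (1 / 2)).congr_lead
    ((Real.continuous_sin.continuousAt.eventually_ne hθ).mono fun _ hsin =>
      flatChristoffel_eq hsin l m n)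

theorem riemann (a b m n : Fin 4) :
    HasLead θ₀ (weight b + weight m + weight n - weight a - 2) (riemann g a b m n)
      fun _ => 0 := by
  have hΓ := christoffel hg hgi hθ
  have hderiv : HasLead θ₀ (weight b + weight m + weight n - weight a - 2) _ _ :=
    ((hΓ a n b).pd m).congr.sub ((hΓ a m b).pd n).congr
  have hquad (l : Fin 4) : HasLead θ₀ (weight b + weight m + weight n - weight a - 2) _ _ :=
    ((hΓ a m l).mul (hΓ l n b)).congr.sub ((hΓ a n l).mul (hΓ l m b)).congr
  exact (hderiv.add (HasLead.sum Finset.univ hquad)).congr_lead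
    ((Real.continuous_sin.continuousAt.eventually_ne hθ).mono fun _ hsin =>
      flatRiemann_eq_zero hsin a b m n)

theorem ricci (b n : Fin 4) : HasLead θ₀ (weight b + weight n - 2) (ricci g b n) fun _ => 0 :=
  (HasLead.sum Finset.univ fun a => (riemann hg hgi hθ a b a n).congr).congr rfl
    (fun _ => rfl) (by simp)

theorem gaussBonnet : HasLead θ₀ (-4) (gaussBonnet g) fun _ => 0 := by
  have hR := riemann hg hgi hθ
  have hRic := ricci hg hgi hθ
  have hS : HasLead θ₀ (-2) (ricciScalar g) fun _ => 0 :=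
    (HasLead.sum _ fun b => HasLead.sum _ fun n =>
      ((hgi b n).mul (hRic b n)).congr).congr rfl (fun _ => rfl) (by simp)
  have hRicSq : HasLead θ₀ (-4) (ricciSq g) fun _ => 0 :=
    (HasLead.sum _ fun a => HasLead.sum _ fun b => HasLead.sum _ fun c => HasLead.sum _ fun d =>
      ((((hgi a c).mul (hgi b d)).mul (hRic a b)).mul (hRic c d)).congr).congr rfl
      (fun _ => rfl) (by simp)
  have hRiemSq : HasLead θ₀ (-4) (riemannSq g) fun _ => 0 :=
    (HasLead.sum _ fun a => HasLead.sum _ fun b => HasLead.sum _ fun c => HasLead.sum _ fun d =>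
      HasLead.sum _ fun e => HasLead.sum _ fun f => HasLead.sum _ fun p => HasLead.sum _ fun q =>
      ((((((hg a e).mul (hgi b f)).mul (hgi c p)).mul (hgi d q)).mul (hR a b c d)).mul
        (hR e f p q)).congr).congr rfl (fun _ => rfl) (by simp)
  exact ((hS.sq.sub (hRicSq.const_mul 4)).add hRiemSq).congr rfl (fun _ => rfl) (by simp)

end HasLead

namespace MetricFunctions.IsAMC

variable {h : MetricFunctions} {M J : ℝ} (hA : h.IsAMC M J) {θ₀ : ℝ}
include hA

theorem hasLead_area (θ₀ : ℝ) :
    HasLead θ₀ 2 (fun x => x 1 ^ 2 * h.B (x 1) (x 2) ^ 2) fun _ => 1 :=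
  ((HasLead.radius θ₀).sq.mul (hA.hasLead_B θ₀).sq).congr (by norm_num) (fun _ => rfl)
    (by simp)

theorem hasLead_axial (θ₀ : ℝ) :
    HasLead θ₀ 2 (fun x => x 1 ^ 2 * h.B (x 1) (x 2) ^ 2 * Real.sin (x 2) ^ 2)
      fun θ => Real.sin θ ^ 2 :=
  ((hA.hasLead_area θ₀).mul (HasLead.sin θ₀).sq).congr (by norm_num) (fun _ => rfl)
    fun _ => one_mul _

theorem hasLead_metric (θ₀ : ℝ) (a b : Fin 4) :
    HasLead θ₀ (weight a + weight b) (fun x => h.metric x a b) (flatMetric a b) := by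
  have hω : HasLead θ₀ (-1) (onChart h.ω) fun _ => 0 :=
    (hA.hasLead_ω θ₀).of_order_lt (by norm_num)
  have htt : HasLead θ₀ 0 (fun x => h.metric x 0 0) (flatMetric 0 0) :=
    ((hA.hasLead_N θ₀).sq.neg.add ((hA.hasLead_axial θ₀).mul hω.sq).congr).congr (by norm_num)
      (fun _ => rfl) (by simp [flatMetric])
  have htφ : HasLead θ₀ 1 (fun x => h.metric x 0 3) (flatMetric 0 3) :=
    ((hA.hasLead_axial θ₀).neg.mul hω).congr (by norm_num) (fun _ => rfl) (by simp [flatMetric])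
  have hrr : HasLead θ₀ 0 (fun x => h.metric x 1 1) (flatMetric 1 1) :=
    (hA.hasLead_A θ₀).sq.congr (by norm_num) (fun _ => rfl) (by simp [flatMetric])
  fin_cases a <;> fin_cases b <;>
    first
    | exact HasLead.zero _ _
    | exact htt
    | exact htφ
    | exact hrr
    | exact hA.hasLead_area θ₀
    | exact hA.hasLead_axial θ₀

theorem hasLead_metricInv (hsin : Real.sin θ₀ ≠ 0) (a b : Fin 4) :
    HasLead θ₀ (-(weight a + weight b)) (fun x => h.metricInv x a b) (flatMetricInv a b) := by
  have hω : HasLead θ₀ (-1) (onChart h.ω) fun _ => 0 :=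
    (hA.hasLead_ω θ₀).of_order_lt (by norm_num)
  have hNinv : HasLead θ₀ 0 (fun x => (onChart h.N x ^ 2)⁻¹) fun _ => 1 :=
    ((hA.hasLead_N θ₀).sq.inv (by norm_num)).congr (by norm_num) (fun _ => rfl) (by simp)
  have htt : HasLead θ₀ 0 (fun x => h.metricInv x 0 0) (flatMetricInv 0 0) :=
    hNinv.neg.congr rfl (fun _ => rfl) (by simp [flatMetricInv])
  have htφ : HasLead θ₀ (-1) (fun x => h.metricInv x 0 3) (flatMetricInv 0 3) :=
    (hω.mul hNinv).neg.congr (by norm_num) (fun _ => rfl) (by simp [flatMetricInv])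
  have hrr : HasLead θ₀ 0 (fun x => h.metricInv x 1 1) (flatMetricInv 1 1) :=
    ((hA.hasLead_A θ₀).sq.inv (by norm_num)).congr (by norm_num) (fun _ => rfl)
      (by simp [flatMetricInv])
  have hθθ : HasLead θ₀ (-2) (fun x => h.metricInv x 2 2) (flatMetricInv 2 2) :=
    ((hA.hasLead_area θ₀).inv one_ne_zero).congr rfl (fun _ => rfl) (by simp [flatMetricInv])
  have hφφ : HasLead θ₀ (-2) (fun x => h.metricInv x 3 3) (flatMetricInv 3 3) :=
    (((hA.hasLead_axial θ₀).inv (pow_ne_zero 2 hsin)).sub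
      ((hω.sq.mul hNinv).congr (by norm_num))).congr rfl (fun _ => rfl) (by simp [flatMetricInv])
  fin_cases a <;> fin_cases b <;>
    first
    | exact HasLead.zero _ _
    | exact htt
    | exact htφ
    | exact hrr
    | exact hθθ
    | exact hφφ

theorem hasLead_gaussBonnet {rH : ℝ} (h0 : 0 ≤ rH) (hs : h.IsSpacetime rH)
    (hθ : θ₀ ∈ Ioo 0 Real.pi) : HasLead θ₀ (-4) (gaussBonnet h.metric) fun _ => 0 := by
  have hsin : Real.sin θ₀ ≠ 0 := (Real.sin_pos_of_mem_Ioo hθ).ne'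
  refine HasLead.gaussBonnet (hA.hasLead_metric θ₀) (fun a b => ?_) hsin
  refine (hA.hasLead_metricInv hsin a b).congr_field ?_
  filter_upwards [tendsto_fst.eventually (eventually_gt_atTop rH),
    tendsto_snd.eventually (isOpen_Ioo.mem_nhds hθ)] with p hr hpθ t φ
  rw [hs.inv_metric h0 (x := ![t, p.1, p.2, φ]) ⟨hr, hpθ⟩]

end MetricFunctions.IsAMC

/-! ### Eigenfunctions on the sphere -/

theorem eq_left_of_hasDerivAt_zero {w : ℝ → ℝ} {a b : ℝ} (hw : ContinuousOn w (Icc a b))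
    (hderiv : ∀ y ∈ Ioo a b, HasDerivAt w 0 y) {x : ℝ} (hx : x ∈ Icc a b) : w x = w a := by
  rcases hx.1.eq_or_lt with rfl | hax
  · rfl
  obtain ⟨y, -, hslope⟩ := exists_hasDerivAt_eq_slope w (fun _ => 0) hax
    (hw.mono (Icc_subset_Icc_right hx.2)) fun y hy => hderiv y ⟨hy.1, hy.2.trans_le hx.2⟩
  rcases div_eq_zero_iff.1 hslope.symm with h | h <;> linarith

theorem hasDerivAt_sin_mul_deriv {v : ℝ → ℝ} (hv : ContDiff ℝ 2 v) (θ : ℝ) :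
    HasDerivAt (fun τ => Real.sin τ * deriv v τ)
      (Real.cos θ * deriv v θ + Real.sin θ * deriv (deriv v) θ) θ :=
  (Real.hasDerivAt_sin θ).mul (hv.differentiable_deriv_two θ).hasDerivAt

theorem eq_const_of_sphere_harmonic {c : ℝ → ℝ} (hc : ContDiff ℝ 2 c) (heven : c.Even)
    (hper : c.Periodic (2 * Real.pi))
    (hode : ∀ θ ∈ Ioo 0 Real.pi, deriv (fun τ => Real.sin τ * deriv c τ) θ = 0) :
    c = fun _ => c 0 := by
  have hflux : ∀ θ, HasDerivAt (fun τ => Real.sin τ * deriv c τ) _ θ :=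
    hasDerivAt_sin_mul_deriv hc
  have hderiv : ∀ θ ∈ Ioo 0 Real.pi, deriv c θ = 0 := fun θ hθ => by
    have hconst := eq_left_of_hasDerivAt_zero (fun x _ => (hflux x).continuousAt.continuousWithinAt)
      (fun y hy => hode y hy ▸ (hflux y).differentiableAt.hasDerivAt) (Ioo_subset_Icc_self hθ)
    rw [Real.sin_zero, zero_mul] at hconst
    exact (mul_eq_zero.1 hconst).resolve_left (Real.sin_pos_of_mem_Ioo hθ).ne'
  refine eq_of_even_periodic hc.continuous continuous_const heven hper (fun _ => rfl)
    (fun _ => rfl) fun θ hθ => eq_left_of_hasDerivAt_zero hc.continuous.continuousOn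
      (fun y hy => hderiv y hy ▸ (hc.differentiable two_ne_zero y).hasDerivAt)
      (Ioo_subset_Icc_self hθ)

theorem deriv_mul_cos_add_mul_sin_eq_zero {v : ℝ → ℝ} (hv : ContDiff ℝ 2 v)
    (hode : ∀ θ ∈ Ioo 0 Real.pi,
      2 * v θ * Real.sin θ + deriv (fun τ => Real.sin τ * deriv v τ) θ = 0)
    {θ : ℝ} (hθ : θ ∈ Ioo 0 Real.pi) : deriv v θ * Real.cos θ + v θ * Real.sin θ = 0 := by
  -- The Wronskian `sin θ (v' cos θ + v sin θ)` of `v` and the eigenfunction `cos θ` is constant.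
  have hwronskian : ∀ x, HasDerivAt
      (fun τ => Real.sin τ * deriv v τ * Real.cos τ + v τ * Real.sin τ ^ 2) _ x := fun x =>
    ((hasDerivAt_sin_mul_deriv hv x).mul (Real.hasDerivAt_cos x)).add
      ((hv.differentiable two_ne_zero x).hasDerivAt.mul ((Real.hasDerivAt_sin x).pow 2))
  have hconst := eq_left_of_hasDerivAt_zero
    (fun x _ => (hwronskian x).continuousAt.continuousWithinAt)
    (fun y hy => (hwronskian y).congr_deriv (by
      have := hode y hy
      rw [(hasDerivAt_sin_mul_deriv hv y).deriv] at this
      linear_combination Real.cos y * this)) (Ioo_subset_Icc_self hθ)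
  have hfactor : Real.sin θ * (deriv v θ * Real.cos θ + v θ * Real.sin θ) = 0 := by
    rw [Real.sin_zero] at hconst
    linear_combination hconst
  exact (mul_eq_zero.1 hfactor).resolve_left (Real.sin_pos_of_mem_Ioo hθ).ne'

theorem eq_mul_cos_of_sphere_eigenfunction {v : ℝ → ℝ} (hv : ContDiff ℝ 2 v) (heven : v.Even)
    (hper : v.Periodic (2 * Real.pi))
    (hode : ∀ θ ∈ Ioo 0 Real.pi,
      2 * v θ * Real.sin θ + deriv (fun τ => Real.sin τ * deriv v τ) θ = 0) :
    v = fun θ => v 0 * Real.cos θ := by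
  have hfirst : ∀ θ ∈ Ioo 0 Real.pi, deriv v θ * Real.cos θ + v θ * Real.sin θ = 0 :=
    fun θ hθ => deriv_mul_cos_add_mul_sin_eq_zero hv hode hθ
  have hoscillator : ∀ θ ∈ Ioo 0 Real.pi, v θ + deriv (deriv v) θ = 0 := fun θ hθ => by
    have hode := hode θ hθ
    rw [(hasDerivAt_sin_mul_deriv hv θ).deriv] at hode
    have hfactor : Real.sin θ * (v θ + deriv (deriv v) θ) = 0 := by
      linear_combination hode - hfirst θ hθ
    exact (mul_eq_zero.1 hfactor).resolve_left (Real.sin_pos_of_mem_Ioo hθ).ne'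
  have hamplitude : ∀ x, HasDerivAt (fun τ => v τ * Real.cos τ - Real.sin τ * deriv v τ) _ x :=
    fun x => ((hv.differentiable two_ne_zero x).hasDerivAt.mul (Real.hasDerivAt_cos x)).sub
      (hasDerivAt_sin_mul_deriv hv x)
  refine eq_of_even_periodic hv.continuous (continuous_const.mul Real.continuous_cos) heven hper
    (fun θ => by rw [Real.cos_neg]) (fun θ => by rw [Real.cos_add_two_pi]) fun θ hθ => ?_
  have hconst := eq_left_of_hasDerivAt_zero
    (fun x _ => (hamplitude x).continuousAt.continuousWithinAt)
    (fun y hy => (hamplitude y).congr_deriv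
      (by linear_combination -Real.sin y * hoscillator y hy)) (Ioo_subset_Icc_self hθ)
  rw [Real.cos_zero, Real.sin_zero, zero_mul, sub_zero, mul_one] at hconst
  linear_combination (-v θ) * Real.sin_sq_add_cos_sq θ + Real.cos θ * hconst +
    Real.sin θ * hfirst θ hθ

theorem HasLead.contDiff_lead {k : ℤ} {f : (Fin 4 → ℝ) → ℝ} {f₀ : ℝ → ℝ}
    (hf : ∀ θ₀, HasLead θ₀ k f f₀) : ContDiff ℝ (⊤ : ℕ∞) f₀ :=
  contDiff_iff_contDiffAt.2 fun θ => (hf θ).contDiffAt_lead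

theorem IsRegularOutside.even_lead {rH : ℝ} {k : ℤ} {f : ℝ → ℝ → ℝ} {f₀ : ℝ → ℝ}
    (hf : IsRegularOutside rH f) (hlead : ∀ θ₀, HasLead θ₀ k (onChart f) f₀) : f₀.Even :=
  fun θ => by
    refine tendsto_nhds_unique_of_eventuallyEq ((hlead (-θ)).tendsto 0 0)
      ((hlead θ).tendsto 0 0) ?_
    filter_upwards [eventually_gt_atTop rH] with r hr
    exact congrArg (r ^ (-k) * ·) (hf.even r hr θ)

theorem IsRegularOutside.periodic_lead {rH : ℝ} {k : ℤ} {f : ℝ → ℝ → ℝ} {f₀ : ℝ → ℝ}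
    (hf : IsRegularOutside rH f) (hlead : ∀ θ₀, HasLead θ₀ k (onChart f) f₀) :
    f₀.Periodic (2 * Real.pi) := fun θ => by
  refine tendsto_nhds_unique_of_eventuallyEq ((hlead (θ + 2 * Real.pi)).tendsto 0 0)
    ((hlead θ).tendsto 0 0) ?_
  filter_upwards [eventually_gt_atTop rH] with r hr
  exact congrArg (r ^ (-k) * ·) (hf.periodic r hr θ)

theorem modeOne_const (c : ℝ) : modeOne (fun _ => c) = 0 := by
  have hantideriv : ∀ θ ∈ uIcc 0 Real.pi, HasDerivAt (fun θ => c / 2 * Real.sin θ ^ 2)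
      (c * Real.cos θ * Real.sin θ) θ := fun θ _ =>
    (((Real.hasDerivAt_sin θ).pow 2).const_mul (c / 2)).congr_deriv (by push_cast; ring)
  rw [modeOne, intervalIntegral.integral_eq_sub_of_hasDerivAt hantideriv
    (Continuous.intervalIntegrable (by fun_prop) _ _), Real.sin_pi, Real.sin_zero]
  ring

/-! ### Reflection of the homogeneous solution and of the scalar hair -/

theorem pi_sub_mem_Ioo {θ : ℝ} (hθ : θ ∈ Ioo 0 Real.pi) : Real.pi - θ ∈ Ioo 0 Real.pi :=
  ⟨sub_pos.2 hθ.2, sub_lt_self _ hθ.1⟩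

theorem isRegularOutside_div {rH : ℝ} (h0 : 0 ≤ rH) (m : ℝ) :
    IsRegularOutside rH fun r _ => m / r where
  contDiffOn := contDiffOn_const.div contDiffOn_fst fun _ hp => (h0.trans_lt hp.1).ne'
  even _ _ _ := rfl
  periodic _ _ _ := rfl

namespace MetricFunctions

variable {h : MetricFunctions} {rH M J : ℝ}

theorem IsSpacetime.waveOp_of_box_add_eq_zero (hs : h.IsSpacetime rH) (h0 : 0 ≤ rH)
    {f : ℝ → ℝ → ℝ} {S t φ r θ : ℝ} (hr : rH < r) (hθ : θ ∈ Ioo 0 Real.pi)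
    (hbox : box h.metric (onChart f) ![t, r, θ, φ] + S = 0) :
    h.waveOp f r θ = -(h.volumeDensity r θ * S) := by
  have hvol := (hs.volumeDensity_pos h0 hr hθ).ne'
  rw [hs.box_onChart h0 f t φ hr hθ] at hbox
  field_simp at hbox
  linear_combination hbox

theorem harmonic_lead_of_waveOp_eq_zero (hA : h.IsAMC M J) {χ : ℝ → ℝ → ℝ} {c : ℝ → ℝ}
    (heq : ∀ r > rH, ∀ θ ∈ Ioo 0 Real.pi, h.waveOp χ r θ = 0)
    (hlead : ∀ θ₀, HasLead θ₀ 0 (onChart χ) c) :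
    ∀ θ ∈ Ioo 0 Real.pi, deriv (fun τ => Real.sin τ * deriv c τ) θ = 0 := fun θ hθ => by
  have hzero : HasLead θ 0 (onChart (h.waveOp χ)) fun _ => 0 := by
    refine (HasLead.zero θ 0).congr_field ?_
    filter_upwards [tendsto_fst.eventually (eventually_gt_atTop rH),
      tendsto_snd.eventually (isOpen_Ioo.mem_nhds hθ)] with p hr hpθ _ _
    exact (heq p.1 hr p.2 hpθ).symm
  simpa using (hA.hasLead_waveOp (hlead θ)).lead_unique hzero

theorem eq_zero_of_hasLead_zero (hs : h.IsSpacetime rH) (hA : h.IsAMC M J)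
    (hinner : h.IsBlackHole rH ∨ h.IsNeutronStar rH) {χ : ℝ → ℝ → ℝ} {c : ℝ → ℝ}
    (hχ : IsRegularOutside rH χ) (hbdd : h.IsRadiallyBounded rH χ)
    (heq : ∀ r > rH, ∀ θ ∈ Ioo 0 Real.pi, h.waveOp χ r θ = 0)
    (hlead : ∀ θ₀, HasLead θ₀ 0 (onChart χ) c) (hc : ∃ θ, c θ = 0) :
    ∀ r > rH, ∀ θ, χ r θ = 0 := by
  have hconst : c = fun _ => c 0 := eq_const_of_sphere_harmonic
    (contDiff_infty.1 (HasLead.contDiff_lead hlead) 2) (hχ.even_lead hlead)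
    (hχ.periodic_lead hlead)
    (harmonic_lead_of_waveOp_eq_zero hA heq hlead)
  obtain ⟨θ, hθ⟩ := hc
  have hzero : c = fun _ => 0 := by
    rw [hconst, ← hθ, hconst]
  exact eq_zero_of_hasLead hs hA hinner hχ hbdd heq (hzero ▸ hlead)

namespace IsHomogeneousSolution

variable {φ₀ : ℝ → ℝ → ℝ}

theorem hasLead (hφ : h.IsHomogeneousSolution rH φ₀) (θ₀ : ℝ) :
    ∃ f₀, HasLead θ₀ 1 (onChart φ₀) f₀ := by
  obtain ⟨f₀, hf₀⟩ := hφ.smooth.exists_hasLead θ₀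
  refine ⟨_, ((HasLead.radius θ₀).mul hf₀).congr_field ?_⟩
  filter_upwards [eventually_fst_pos θ₀] with p hp t φ
  exact mul_div_cancel₀ (φ₀ p.1 p.2) hp.ne'

theorem hasLead_add_comp_pi_sub (hφ : h.IsHomogeneousSolution rH φ₀) :
    ∃ φ₁ : ℝ → ℝ, ∀ θ₀, HasLead θ₀ 0 (onChart fun r θ => φ₀ r θ + φ₀ r (Real.pi - θ))
      fun θ => Real.cos θ * (φ₁ θ - φ₁ (Real.pi - θ)) := by
  obtain ⟨φ₁, hφ₁⟩ := hφ.expand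
  refine ⟨φ₁, fun θ₀ => ?_⟩
  obtain ⟨f₀, hf₀⟩ := hφ.hasLead θ₀
  obtain ⟨g₀, hg₀⟩ := hφ.hasLead (Real.pi - θ₀)
  refine (hf₀.add hg₀.comp_pi_sub).of_tendsto zero_le_one fun θ => ?_
  have hlim := ((hφ₁.tendsto_pow_mul zero_lt_one θ).add
    (hφ₁.tendsto_pow_mul zero_lt_one (Real.pi - θ))).add_const
      (Real.cos θ * (φ₁ θ - φ₁ (Real.pi - θ)))
  rw [add_zero, zero_add] at hlim
  refine hlim.congr' ?_
  filter_upwards [eventually_ne_atTop 0] with r hr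
  simp only [onChart, Matrix.cons_val, Real.cos_pi_sub, neg_zero, zpow_zero, one_mul, pow_zero]
  field_simp
  ring

theorem comp_pi_sub (hs : h.IsSpacetime rH) (hrefl : h.IsReflectionSymmetric rH)
    (hA : h.IsAMC M J) (hinner : h.IsBlackHole rH ∨ h.IsNeutronStar rH)
    (hφ : h.IsHomogeneousSolution rH φ₀) {r : ℝ} (hr : rH < r) (θ : ℝ) :
    φ₀ r (Real.pi - θ) = -φ₀ r θ := by
  have h0 := inner_nonneg hinner
  have hmetric {s : ℝ} (hs' : s > rH) := hrefl.eq_pi_sub h0 hs hs'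
  have hreg := hφ.regular.comp_pi_sub
  have hbdd := hφ.inside.isRadiallyBounded
  have hwave : ∀ r > rH, ∀ θ ∈ Ioo 0 Real.pi, h.waveOp φ₀ r θ = 0 := fun r hr θ hθ => by
    have hbox := hφ.equation 0 0 r hr θ hθ
    rw [← add_zero (box _ _ _)] at hbox
    rw [hs.waveOp_of_box_add_eq_zero h0 hr hθ hbox, mul_zero, neg_zero]
  obtain ⟨φ₁, hlead⟩ := hφ.hasLead_add_comp_pi_sub
  have hsum := eq_zero_of_hasLead_zero hs hA hinner (hφ.regular.add hreg)
    (hbdd.add (hbdd.comp_pi_sub fun r hr θ => (hmetric hr θ).2.1) hφ.regular hreg)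
    (fun r hr θ hθ => by
      rw [hs.waveOp_add hφ.regular hreg hr, waveOp_comp_pi_sub (fun r hr θ => (hmetric hr θ).1)
        (fun r hr θ => (hmetric hr θ).2.1) (fun r hr θ => (hmetric hr θ).2.2) hr,
        hwave r hr θ hθ, hwave r hr _ (pi_sub_mem_Ioo hθ), add_zero])
    hlead ⟨Real.pi / 2, by simp⟩ r hr θ
  exact eq_neg_of_add_eq_zero_right hsum

end IsHomogeneousSolution

namespace IsSGBScalar

variable {ε : ℝ} {Φ : ℝ → ℝ → ℝ} {μ₁ μ₂ : ℝ → ℝ}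

theorem hasLead (hΦ : h.IsSGBScalar rH ε Φ μ₁ μ₂) (θ₀ : ℝ) : HasLead θ₀ (-1) (onChart Φ) μ₁ := by
  obtain ⟨f₀, hf₀⟩ := hΦ.smooth.exists_hasLead θ₀
  refine hf₀.of_tendsto (by norm_num) fun θ => ?_
  have hlim := ((hΦ.expand.tendsto_pow_mul (by norm_num : 1 < 3) θ).add_const (μ₁ θ)).add
    (tendsto_inv_atTop_zero.const_mul (μ₂ θ))
  rw [zero_add, mul_zero, add_zero] at hlim
  refine hlim.congr' ?_
  filter_upwards [eventually_ne_atTop 0] with r hr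
  simp only [onChart, Matrix.cons_val, neg_neg, zpow_one]
  field_simp
  ring

theorem comp_pi_sub (hs : h.IsSpacetime rH) (hrefl : h.IsReflectionSymmetric rH)
    (hA : h.IsAMC M J) (hinner : h.IsBlackHole rH ∨ h.IsNeutronStar rH)
    (hΦ : h.IsSGBScalar rH ε Φ μ₁ μ₂) {r : ℝ} (hr : rH < r) (θ : ℝ) :
    Φ r (Real.pi - θ) = Φ r θ := by
  have h0 := inner_nonneg hinner
  have hmetric {s : ℝ} (hs' : s > rH) := hrefl.eq_pi_sub h0 hs hs'
  have hreg := hΦ.regular.comp_pi_sub.neg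
  have hbdd := hΦ.inside.isRadiallyBounded
  have hwave : ∀ r > rH, ∀ θ ∈ Ioo 0 Real.pi,
      h.waveOp Φ r (Real.pi - θ) = h.waveOp Φ r θ := fun r hr θ hθ => by
    have hθ' := pi_sub_mem_Ioo hθ
    obtain ⟨hN, hA, hB⟩ := hmetric hr θ
    rw [hs.waveOp_of_box_add_eq_zero h0 hr hθ (hΦ.equation 0 0 r hr θ hθ),
      hs.waveOp_of_box_add_eq_zero h0 hr hθ' (hΦ.equation 0 0 r hr _ hθ'),
      hrefl.gaussBonnet_pi_sub h0 hs 0 0 hr hθ]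
    simp only [volumeDensity, hN, hA, hB, Real.sin_pi_sub]
  have hlead (θ₀ : ℝ) := ((hΦ.hasLead θ₀).of_order_lt (l := 0) (by norm_num)).add
    (((hΦ.hasLead (Real.pi - θ₀)).of_order_lt (l := 0) (by norm_num)).comp_pi_sub.neg)
  have hdiff := eq_zero_of_hasLead hs hA hinner (hΦ.regular.add hreg)
    (hbdd.add (hbdd.comp_pi_sub fun r hr θ => (hmetric hr θ).2.1).neg hΦ.regular hreg)
    (fun r hr θ hθ => by
      rw [hs.waveOp_add hΦ.regular hreg hr, waveOp_neg h fun r θ => Φ r (Real.pi - θ),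
        waveOp_comp_pi_sub (fun r hr θ => (hmetric hr θ).1)
        (fun r hr θ => (hmetric hr θ).2.1) (fun r hr θ => (hmetric hr θ).2.2) hr,
        hwave r hr θ hθ, add_neg_cancel])
    (fun θ₀ => (hlead θ₀).congr_lead (.of_forall fun _ => by norm_num)) r hr θ
  exact (eq_of_sub_eq_zero (sub_eq_add_neg (Φ r θ) _ ▸ hdiff)).symm

theorem hasLead_waveOp (hΦ : h.IsSGBScalar rH ε Φ μ₁ μ₂) (hs : h.IsSpacetime rH)
    (hA : h.IsAMC M J) (h0 : 0 ≤ rH) {θ : ℝ} (hθ : θ ∈ Ioo 0 Real.pi) :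
    HasLead θ (-2) (onChart (h.waveOp Φ)) fun _ => 0 := by
  have hvol : HasLead θ 2 (onChart h.volumeDensity) Real.sin :=
    ((((hA.hasLead_N θ).mul (hA.hasLead_A θ)).mul (hA.hasLead_area θ)).mul (HasLead.sin θ)).congr
      (by norm_num) (fun _ => rfl) fun _ => by ring
  have hsource : HasLead θ (-2)
      (fun x => -(onChart h.volumeDensity x * (ε * gaussBonnet h.metric x))) fun _ => 0 :=
    (hvol.mul ((hA.hasLead_gaussBonnet h0 hs hθ).const_mul ε)).neg.congr (by norm_num)
      (fun _ => rfl) fun _ => by ring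
  refine hsource.congr_field ?_
  filter_upwards [tendsto_fst.eventually (eventually_gt_atTop rH),
    tendsto_snd.eventually (isOpen_Ioo.mem_nhds hθ)] with p hr hpθ t φ
  exact (hs.waveOp_of_box_add_eq_zero h0 hr hpθ (hΦ.equation t φ p.1 hr p.2 hpθ)).symm

theorem monopole_const (hs : h.IsSpacetime rH) (hA : h.IsAMC M J) (h0 : 0 ≤ rH)
    (hΦ : h.IsSGBScalar rH ε Φ μ₁ μ₂) : μ₁ = fun _ => μ₁ 0 := by
  refine eq_const_of_sphere_harmonic (contDiff_infty.1 (HasLead.contDiff_lead hΦ.hasLead) 2)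
    (hΦ.regular.even_lead hΦ.hasLead) (hΦ.regular.periodic_lead hΦ.hasLead) fun θ hθ => ?_
  have hwave := (hΦ.hasLead_waveOp hs hA h0 hθ).of_order_lt (l := -1) (by norm_num)
  simpa using (hA.hasLead_waveOp (hΦ.hasLead θ)).lead_unique hwave

theorem hasLead_sub_monopole {m : ℝ} (hΦ : h.IsSGBScalar rH ε Φ μ₁ μ₂) (hm : μ₁ = fun _ => m)
    (θ₀ : ℝ) : HasLead θ₀ (-2) (onChart fun r θ => Φ r θ + -(m / r)) μ₂ := by
  obtain ⟨f₀, hf₀⟩ := hΦ.smooth.exists_hasLead θ₀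
  have hdiv : HasLead θ₀ 0 (onChart fun r _ => -(m / r)) _ :=
    ((((HasLead.radius θ₀).inv one_ne_zero).const_mul m).neg.of_order_lt (by norm_num))
  refine (hf₀.add hdiv).of_tendsto (by norm_num) fun θ => ?_
  have hlim := (hΦ.expand.tendsto_pow_mul (by norm_num : 2 < 3) θ).add_const (μ₂ θ)
  rw [zero_add] at hlim
  refine hlim.congr' ?_
  filter_upwards [eventually_ne_atTop 0] with r hr
  simp only [onChart, Matrix.cons_val, neg_neg, hm]
  norm_cast
  field_simp
  ring

theorem dipole_ode {m : ℝ} (hs : h.IsSpacetime rH) (hA : h.IsAMC M J) (h0 : 0 ≤ rH)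
    (hΦ : h.IsSGBScalar rH ε Φ μ₁ μ₂) (hm : μ₁ = fun _ => m) {θ : ℝ} (hθ : θ ∈ Ioo 0 Real.pi) :
    2 * (μ₂ θ - M * m) * Real.sin θ + deriv (fun τ => Real.sin τ * deriv μ₂ τ) θ = 0 := by
  have hreg := isRegularOutside_div h0 m
  have hdiff := (hΦ.hasLead_waveOp hs hA h0 hθ).sub (hA.hasLead_waveOp_monopole θ m)
  have hwave : HasLead θ (-2) (onChart (h.waveOp fun r θ => Φ r θ + -(m / r)))
      fun θ => 0 - -2 * M * m * Real.sin θ := by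
    refine hdiff.congr_field ?_
    filter_upwards [tendsto_fst.eventually (eventually_gt_atTop rH)] with p hr t φ
    simp only [onChart, Matrix.cons_val, hs.waveOp_add hΦ.regular hreg.neg hr,
      waveOp_neg h fun r _ => m / r, sub_eq_add_neg]
  have hlead := (hA.hasLead_waveOp (hΦ.hasLead_sub_monopole hm θ)).lead_unique hwave
  push_cast at hlead
  linear_combination hlead

theorem dipole_eq (hs : h.IsSpacetime rH) (hrefl : h.IsReflectionSymmetric rH)
    (hA : h.IsAMC M J) (hinner : h.IsBlackHole rH ∨ h.IsNeutronStar rH)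
    (hΦ : h.IsSGBScalar rH ε Φ μ₁ μ₂) : μ₂ = fun _ => M * μ₁ 0 := by
  have h0 := inner_nonneg hinner
  have hlead := hΦ.hasLead_sub_monopole (hΦ.monopole_const hs hA h0)
  have hreg := hΦ.regular.add (isRegularOutside_div h0 (μ₁ 0)).neg
  have hpi : μ₂ Real.pi = μ₂ 0 := by
    refine tendsto_nhds_unique_of_eventuallyEq ((hlead Real.pi).tendsto 0 0)
      ((hlead 0).tendsto 0 0) ?_
    filter_upwards [eventually_gt_atTop rH] with r hr
    simp only [onChart, Matrix.cons_val, ← hΦ.comp_pi_sub hs hrefl hA hinner hr 0, sub_zero]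
  have hcos := eq_mul_cos_of_sphere_eigenfunction (v := fun θ => μ₂ θ - M * μ₁ 0)
    ((contDiff_infty.1 (HasLead.contDiff_lead hlead) 2).sub contDiff_const)
    (fun θ => congrArg (· - M * μ₁ 0) (hreg.even_lead hlead θ))
    (fun θ => congrArg (· - M * μ₁ 0) (hreg.periodic_lead hlead θ)) fun θ hθ => by
      simpa only [deriv_sub_const_fun] using
        hΦ.dipole_ode hs hA h0 (hΦ.monopole_const hs hA h0) hθ
  have hzero : μ₂ 0 - M * μ₁ 0 = 0 := by
    have hcos_pi := congrFun hcos Real.pi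
    rw [hpi, Real.cos_pi] at hcos_pi
    linarith
  funext θ
  simpa [hzero, sub_eq_zero] using congrFun hcos θ

end IsSGBScalar

end MetricFunctions

end SGB

end

theorem mainTheorem6 (h : SGB.MetricFunctions) (rH M J ε : ℝ)
    (hspace : h.IsSpacetime rH)
    (hrefl : h.IsReflectionSymmetric rH)
    (hAMC : h.IsAMC M J)
    (hinner : h.IsBlackHole rH ∨ h.IsNeutronStar rH) :
    -- the Gauss–Bonnet invariant is even under reflection
    (∀ t φ : ℝ, ∀ r > rH, ∀ θ ∈ Set.Ioo 0 Real.pi,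
      SGB.gaussBonnet h.metric ![t, r, θ, φ] =
        SGB.gaussBonnet h.metric ![t, r, Real.pi - θ, φ]) ∧
    -- the homogeneous solution is odd under reflection
    (∀ φ₀ : ℝ → ℝ → ℝ, h.IsHomogeneousSolution rH φ₀ →
      ∀ r > rH, ∀ θ, φ₀ r (Real.pi - θ) = -φ₀ r θ) ∧
    -- the dipole hair has no `ℓ = 1` mode, and the scalar has the stated expansion
    (∀ (Φ : ℝ → ℝ → ℝ) (μ₁ μ₂ : ℝ → ℝ), h.IsSGBScalar rH ε Φ μ₁ μ₂ →
      SGB.modeOne μ₂ = 0 ∧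
      ∃ m₁ : ℝ, (∀ θ, μ₁ θ = m₁) ∧
        (∀ θ, μ₂ θ = M * m₁ + SGB.modeOne μ₂ * Real.cos θ) ∧
        SGB.IsBigOInv 3 fun r θ => Φ r θ - (m₁ / r + M * m₁ / r ^ 2)) := by
  have h0 := SGB.MetricFunctions.inner_nonneg hinner
  refine ⟨fun t φ r hr θ hθ => (hrefl.gaussBonnet_pi_sub h0 hspace t φ hr hθ).symm,
    fun φ₀ hφ r hr θ => hφ.comp_pi_sub hspace hrefl hAMC hinner hr θ, fun Φ μ₁ μ₂ hΦ => ?_⟩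
  have hmonopole : μ₁ = fun _ => μ₁ 0 := hΦ.monopole_const hspace hAMC h0
  have hdipole : μ₂ = fun _ => M * μ₁ 0 := hΦ.dipole_eq hspace hrefl hAMC hinner
  have hmode : SGB.modeOne μ₂ = 0 := by rw [hdipole, SGB.modeOne_const]
  have hexpand := hΦ.expand
  rw [hmonopole, hdipole] at hexpand
  refine ⟨hmode, μ₁ 0, congrFun hmonopole, fun θ => ?_, hexpand⟩
  rw [hmode, zero_mul, add_zero, congrFun hdipole θ]
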